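/- Consider $n$ devices sharing a multiple-access channel in synchronous rounds, all starting at time zero. In each round a device transmits a message, listens, or stays idle. In the $\mathsf{No}\text{-}\mathsf{CD}$ model, transmitters receive no feedback, and a listener receives the message $m$ if exactly one device transmits in the round, and silence if zero or at least two devices transmit. The devices are anonymous: they all run the same randomized algorithm, which does not depend on $n$; each device has its own independent sequence of fair random bits, and its behaviour depends only on these bits and on the feedback it has received so far. A leader is elected if the execution ends, simultaneously for all devices, with a round in which exactly one device transmits and all other devices listen, upon which the transmitting device terminates as the leader and all others terminate as non-leaders. The time of an execution is the number of rounds until all devices have terminated; its energy is the maximum, over all devices, of the number of rounds in which the device transmits or listens. Theorem (Lavault, Marckert, Ravelomanana). In the $\mathsf{No}\text{-}\mathsf{CD}$ model there are a single algorithm $\mathcal{A}$ and a constant $C$ such that for every number $n \ge 2$ of devices (unknown to the devices), $\mathcal{A}$ elects a leader with probability $1$ and never errs (in every execution, a device terminates only through a correct election as above), and - the expected time of $\mathcal{A}$ on $n$ devices is at most $C \log_2 n$, that is, $O(\log n)$; - the expected energy of $\mathcal{A}$ on $n$ devices is at most $C\,(1 + \log_2 \log_2 n)$, that is, $O(\log\log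 n)$. -/

import Mathlib

open MeasureTheory
open scoped ENNReal

namespace NoCD

/-- What a device does in one communication round. -/
inductive Action where
  | transmit (m : ℕ)
  | listen
  | idle
  deriving DecidableEq

/-- What a device observes at the end of one communication round.
`nothing` is the (empty) observation of a device that transmitted or was idle. -/
inductive Feedback where
  | nothing
  | silence
  | message (m : ℕ)
  deriving DecidableEq

/-- The final decision of a device. -/
inductive Role where
  | leader
  | nonLeader
  deriving DecidableEq

instance : MeasurableSpace Action := ⊤

instance : MeasurableSpace (Option Role) := ⊤

/-- The message sent by an action, if it is a transmission. -/
def Action.sent : Action → Option ℕ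
  | .transmit m => some m
  | _ => none

/-- The content of the channel in a round: the message `m` if exactly one device transmits,
and `none` if zero or at least two devices transmit. -/
def channel {n : ℕ} (a : Fin n → Action) : Option ℕ :=
  match (List.finRange n).filterMap (fun v => (a v).sent) with
  | [m] => some m
  | _ => none

/-- The feedback to device `v` without collision detection: transmitters (and idle devices) observe
nothing, and a listener cannot tell a collision from silence. -/
def feedback {n : ℕ} (a : Fin n → Action) (v : Fin n) : Feedback :=
  match a v with
  | .listen =>
    match channel a with
    | some m => .message m
    | none => .silence
  | _ => .nothing

/-- The private random bits of one device. -/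
abbrev Seed := ℕ → Bool

/-- A sequence of independent fair bits. -/
noncomputable def seedMeasure : Measure Seed :=
  Measure.infinitePi (fun _ : ℕ => (PMF.uniformOfFintype Bool).toMeasure)

/-- The private random bits of `n` devices, independent across devices. -/
noncomputable def seedsMeasure (n : ℕ) : Measure (Fin n → Seed) :=
  Measure.pi (fun _ : Fin n => seedMeasure)

/-- A randomized algorithm for anonymous devices: the same algorithm is run by every device, and the
behaviour of a device depends only on its own random bits and on its own past observations
(one per past round, the most recent one first). In particular it depends neither on an identity
of the device nor on the number of devices.

`output r h = none` means that the device is still running after the observations `h`;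
`output r h = some x` means that it has terminated with the decision `x`. -/
structure Algorithm where
  action : Seed → List Feedback → Action
  output : Seed → List Feedback → Option Role
  measurable_action : ∀ h, Measurable fun r => action r h
  measurable_output : ∀ h, Measurable fun r => output r h

namespace Algorithm

variable (A : Algorithm) {n : ℕ}

/-- The action of a device in the next round; a terminated device is idle forever. -/
def move (r : Seed) (h : List Feedback) : Action :=
  match A.output r h with
  | none => A.action r h
  | some _ => .idle

/-- The observations of each device in the first `t` rounds of the execution of `A` on `n` devices
with random bits `ω`; a device that has terminated makes no further observations. -/
def history (ω : Fin n → Seed) : ℕ → Fin n → List Feedback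
  | 0 => fun _ => []
  | t + 1 => fun v =>
    match A.output (ω v) (history ω t v) with
    | none => feedback (fun w => A.move (ω w) (history ω t w)) v :: history ω t v
    | some _ => history ω t v

/-- The decision of device `v` after `t` rounds (`none` if it is still running). -/
def outputAt (ω : Fin n → Seed) (t : ℕ) (v : Fin n) : Option Role :=
  A.output (ω v) (A.history ω t v)

/-- The action of device `v` in round `t + 1`, that is, after `t` rounds have passed. -/
def actionAt (ω : Fin n → Seed) (t : ℕ) (v : Fin n) : Action :=
  A.move (ω v) (A.history ω t v)

/-- The execution ends with round `t + 1`, in which `ℓ` is elected: all devices run until this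
round, in it `ℓ` transmits while every other device listens, and right after it `ℓ` terminates as the
leader and every other device terminates as a non-leader. -/
def ElectedAt (ω : Fin n → Seed) (t : ℕ) (ℓ : Fin n) : Prop :=
  (∀ v, A.outputAt ω t v = none) ∧
  (∃ m, A.actionAt ω t ℓ = .transmit m) ∧
  (∀ v, v ≠ ℓ → A.actionAt ω t v = .listen) ∧
  A.outputAt ω (t + 1) ℓ = some .leader ∧
  (∀ v, v ≠ ℓ → A.outputAt ω (t + 1) v = some .nonLeader)

/-- `A` is a Las Vegas leader election algorithm on `n` devices: it never errs, in that a device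
terminates only through a correct election, and a leader is elected with probability one. -/
def ElectsLeader (n : ℕ) : Prop :=
  (∀ (ω : Fin n → Seed) (t : ℕ) (v : Fin n), A.outputAt ω t v ≠ none →
    ∃ s < t, ∃ ℓ, A.ElectedAt ω s ℓ) ∧
  (∀ᵐ ω ∂seedsMeasure n, ∃ t ℓ, A.ElectedAt ω t ℓ)

/-- The number of rounds until all devices have terminated (`∞` if this never happens). -/
noncomputable def time (ω : Fin n → Seed) : ℝ≥0∞ :=
  ⨅ (t : ℕ) (_ : ∀ v, A.outputAt ω t v ≠ none), (t : ℝ≥0∞)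

/-- The number of rounds in which device `v` transmits or listens. -/
noncomputable def deviceEnergy (ω : Fin n → Seed) (v : Fin n) : ℝ≥0∞ :=
  ∑' t : ℕ, if A.actionAt ω t v = .idle then 0 else 1

/-- The maximum number of non-idle rounds over all devices. -/
noncomputable def energy (ω : Fin n → Seed) : ℝ≥0∞ :=
  ⨆ v, A.deviceEnergy ω v

/-- The expected time of `A` on `n` devices. -/
noncomputable def expectedTime (n : ℕ) : ℝ≥0∞ :=
  ∫⁻ ω, A.time ω ∂seedsMeasure n

/-- The expected energy of `A` on `n` devices. -/
noncomputable def expectedEnergy (n : ℕ) : ℝ≥0∞ :=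
  ∫⁻ ω, A.energy ω ∂seedsMeasure n

end Algorithm

end NoCD

/-! ### Channel and observations -/

namespace NoCD

/-! The algorithm runs in phases. In a phase with `L` slots every device draws slot `k` with
probability `2⁻¹ ^ (k + 1)` and independently becomes a sender with probability `2⁻¹ ^ 10`,
otherwise a receiver. Acknowledgements replace collision detection: a sender hears one exactly when
its slot holds one sender and one receiver (`IsPhase.winner_iff`). All such winners announce
themselves in one common round, which is heard only if there is a single winner; its receiver then
confirms. Hence either nobody terminates or a correct election takes place
(`exists_electedAt_of_terminated`).

A phase with at least `Nat.log 2 n` slots succeeds with probability at least `2⁻¹ ^ 17`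
(`ticketsLaw_good_ge`). Near slot `log₂ n` the expected number of sender-receiver pairs is bounded
below. Given such a pair, a union bound controls pairs in other slots: the number of ordered pairs
of devices alone together in some slot has bounded expectation whatever the number of devices
(`sum_pair_prob_le`), and the rarity of senders makes the resulting failure probability small.

Phase `j` has about `growth ^ j` slots, so enough slots are available from phase `O(log log n)` on,
after total time `O(log n)`. From then on the number of phases has a geometric tail with ratio `1 -
2⁻¹ ^ 17`; as `growth` times this ratio is below 1, the expected time stays `O(log n)`. A device is
active in at most five rounds of a phase, for every outcome of the random bits, so taking the
maximum over devices costs nothing and the energy is at most five times the number of phases. -/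

@[simp] theorem Action.sent_transmit (m : ℕ) : (Action.transmit m).sent = some m := rfl

@[simp] theorem Action.sent_listen : Action.listen.sent = none := rfl

@[simp] theorem Action.sent_idle : Action.idle.sent = none := rfl

theorem channel_eq_some_iff {n : ℕ} {a : Fin n → Action} {m : ℕ} :
    channel a = some m ↔ ∃ u, a u = .transmit m ∧ ∀ w, w ≠ u → (a w).sent = none := by
  have hsent : ∀ {x : Action}, x.sent = some m → x = .transmit m := by
    intro x hx
    cases x <;> simp_all
  have hch : channel a = some m ↔ (List.finRange n).filterMap (fun v => (a v).sent) = [m] := by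
    unfold channel
    split <;> simp_all
  rw [hch]
  constructor
  · intro h
    obtain ⟨l₁, u, l₂, hl, h₁, hu, h₂⟩ := List.filterMap_eq_cons_iff.1 h
    refine ⟨u, hsent hu, fun w hw => ?_⟩
    have hmem : w ∈ List.finRange n := List.mem_finRange w
    rw [hl, List.mem_append, List.mem_cons] at hmem
    rcases hmem with hmem | hmem | hmem
    · exact h₁ w hmem
    · exact absurd hmem hw
    · exact List.filterMap_eq_nil_iff.1 h₂ w hmem
  · rintro ⟨u, hu, hw⟩
    obtain ⟨l₁, l₂, hl⟩ := List.append_of_mem (List.mem_finRange u)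
    have hnd := List.nodup_finRange n
    rw [hl, List.nodup_middle, List.nodup_cons, List.mem_append, not_or] at hnd
    rw [hl, List.filterMap_append, List.filterMap_cons, hu]
    have h₁ : l₁.filterMap (fun v => (a v).sent) = [] :=
      List.filterMap_eq_nil_iff.2 fun x hx => hw x fun h => hnd.1.1 (h ▸ hx)
    have h₂ : l₂.filterMap (fun v => (a v).sent) = [] :=
      List.filterMap_eq_nil_iff.2 fun x hx => hw x fun h => hnd.1.2 (h ▸ hx)
    simp [h₁, h₂]

theorem feedback_eq_message_iff {n : ℕ} {a : Fin n → Action} {v : Fin n} {m : ℕ} :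
    feedback a v = .message m ↔
      a v = .listen ∧ ∃ u, a u = .transmit m ∧ ∀ w, w ≠ u → (a w).sent = none := by
  rw [← channel_eq_some_iff]
  unfold feedback
  cases a v <;> cases channel a <;> simp

/-- Whether an observation is a message. -/
def Feedback.heard : Feedback → Bool
  | .message _ => true
  | _ => false

@[simp] theorem Feedback.heard_message (m : ℕ) : (Feedback.message m).heard = true := rfl

theorem Feedback.heard_iff {f : Feedback} : f.heard = true ↔ ∃ m, f = .message m := by
  cases f <;> simp [Feedback.heard]

/-! ### The protocol of one phase -/

/-- A sender has won its slot if it heard an acknowledgement. The ticket `τ` of a device consists of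
its slot and of whether it is a sender; `o` lists its observations in the current phase. -/
def winner (L : ℕ) (τ : ℕ × Bool) (o : ℕ → Feedback) : Bool :=
  τ.2 && decide (τ.1 < L) && (o (2 * τ.1 + 1)).heard

/-- The action in round `p` of a phase with `L` slots. Slot `k` consists of the rounds `2 * k`, in
which its senders transmit, and `2 * k + 1`, in which its receivers acknowledge a message. Then the
winners announce their slots, a unique announcement is acknowledged by the receiver of that slot,
and finally the acknowledged winner transmits once more. -/
def phaseAction (L : ℕ) (τ : ℕ × Bool) (o : ℕ → Feedback) (p : ℕ) : Action :=
  if p < 2 * L then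
    if p / 2 = τ.1 then
      if p % 2 = 0 then
        if τ.2 then .transmit 0 else .listen
      else if τ.2 then .listen else if (o (p - 1)).heard then .transmit 0 else .idle
    else .idle
  else if p = 2 * L then
    -- The message is the slot number, so that only receivers of this slot answer. The answer is
    -- needed because a transmitter gets no feedback on collisions.
    if winner L τ o then .transmit τ.1 else .listen
  else if p = 2 * L + 1 then
    if winner L τ o then .listen
    else if τ.2 = false ∧ o (2 * L) = .message τ.1 then .transmit 0 else .idle
  else if (o (2 * L + 1)).heard then .transmit 0
  else if (o (2 * L)).heard then .listen else .idle

/-- The decision at the end of a phase. -/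
def phaseOutput (L : ℕ) (o : ℕ → Feedback) : Option Role :=
  if (o (2 * L + 1)).heard then some .leader
  else if (o (2 * L)).heard then some .nonLeader else none

/-! ### Correctness of one phase -/

section Phase

variable {n : ℕ}

/-- Slot `k` is drawn by exactly two devices, the sender `s` and the receiver `r`. -/
def PairIn (τ : Fin n → ℕ × Bool) (k : ℕ) (s r : Fin n) : Prop :=
  τ s = (k, true) ∧ τ r = (k, false) ∧ ∀ w, w ≠ s → w ≠ r → (τ w).1 ≠ k

/-- Exactly one of the first `L` slots is drawn by exactly one sender and one receiver. -/
def GoodTickets (L : ℕ) (τ : Fin n → ℕ × Bool) : Prop :=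
  ∃ k < L, ∃ s r, PairIn τ k s r ∧ ∀ k' < L, k' ≠ k → ∀ s' r', ¬ PairIn τ k' s' r'

/-- `o` lists the observations of all devices in one phase. -/
def IsPhase (L : ℕ) (τ : Fin n → ℕ × Bool) (o : Fin n → ℕ → Feedback) : Prop :=
  ∀ p < 2 * L + 3, ∀ v, o v p = feedback (fun w => phaseAction L (τ w) (o w) p) v

variable {L : ℕ} {τ : Fin n → ℕ × Bool} {o : Fin n → ℕ → Feedback}

theorem phaseAction_even {k : ℕ} (hk : k < L) (σ : ℕ × Bool) (f : ℕ → Feedback) :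
    phaseAction L σ f (2 * k) =
      if k = σ.1 then (if σ.2 then .transmit 0 else .listen) else .idle := by
  have h₁ : 2 * k < 2 * L := by omega
  have h₂ : 2 * k / 2 = k := by omega
  simp [phaseAction, h₁, h₂]

theorem phaseAction_odd {k : ℕ} (hk : k < L) (σ : ℕ × Bool) (f : ℕ → Feedback) :
    phaseAction L σ f (2 * k + 1) =
      if k = σ.1 then (if σ.2 then .listen else
        if (f (2 * k)).heard then .transmit 0 else .idle) else .idle := by
  have h₁ : 2 * k + 1 < 2 * L := by omega
  have h₂ : (2 * k + 1) / 2 = k := by omega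
  have h₃ : (2 * k + 1) % 2 = 1 := by omega
  simp [phaseAction, h₁, h₂, h₃]

theorem phaseAction_announce (σ : ℕ × Bool) (f : ℕ → Feedback) :
    phaseAction L σ f (2 * L) = if winner L σ f then .transmit σ.1 else .listen := by
  simp [phaseAction]

theorem phaseAction_confirm (σ : ℕ × Bool) (f : ℕ → Feedback) :
    phaseAction L σ f (2 * L + 1) = if winner L σ f then .listen
      else if σ.2 = false ∧ f (2 * L) = .message σ.1 then .transmit 0 else .idle := by
  simp [phaseAction]

theorem phaseAction_last (σ : ℕ × Bool) (f : ℕ → Feedback) :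
    phaseAction L σ f (2 * L + 2) = if (f (2 * L + 1)).heard then .transmit 0
      else if (f (2 * L)).heard then .listen else .idle := by
  simp [phaseAction]

theorem IsPhase.eq_message_iff (h : IsPhase L τ o) {p : ℕ} (hp : p < 2 * L + 3) {v : Fin n}
    {m : ℕ} : o v p = .message m ↔ phaseAction L (τ v) (o v) p = .listen ∧
      ∃ u, phaseAction L (τ u) (o u) p = .transmit m ∧
        ∀ w, w ≠ u → (phaseAction L (τ w) (o w) p).sent = none := by
  rw [h p hp v, feedback_eq_message_iff]

/-- A receiver hears a message in its slot if and only if the slot has a unique sender. -/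
theorem IsPhase.heard_even_iff (h : IsPhase L τ o) {k : ℕ} (hk : k < L) {v : Fin n} :
    (o v (2 * k)).heard = true ↔
      τ v = (k, false) ∧ ∃ u, τ u = (k, true) ∧ ∀ w, w ≠ u → τ w ≠ (k, true) := by
  rw [Feedback.heard_iff]
  simp only [h.eq_message_iff (show 2 * k < 2 * L + 3 by omega), phaseAction_even hk]
  constructor
  · rintro ⟨m, hv, u, hu, hw⟩
    refine ⟨?_, u, ?_, fun w hwu hτ => ?_⟩
    · split_ifs at hv with h₁ h₂
      exact Prod.ext h₁.symm (by simpa using h₂)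
    · split_ifs at hu with h₁ h₂
      exact Prod.ext h₁.symm h₂
    · have := hw w hwu
      simp [hτ] at this
  · rintro ⟨hv, u, hu, hw⟩
    refine ⟨0, by simp [hv], u, by simp [hu], fun w hwu => ?_⟩
    have := hw w hwu
    split_ifs with h₁ h₂
    · exact absurd (Prod.ext h₁.symm h₂) this
    · rfl
    · rfl

/-- All receivers of a slot with a unique sender hear it and all of them acknowledge, so the
acknowledgement gets through only if there is exactly one of them. -/
theorem IsPhase.winner_iff (h : IsPhase L τ o) {v : Fin n} :
    winner L (τ v) (o v) = true ↔ (τ v).1 < L ∧ ∃ r, PairIn τ (τ v).1 v r := by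
  simp only [winner, Bool.and_eq_true, decide_eq_true_eq]
  constructor
  · rintro ⟨⟨hs, hL⟩, hm⟩
    refine ⟨hL, ?_⟩
    obtain ⟨m, hm⟩ := Feedback.heard_iff.1 hm
    obtain ⟨-, r, hr, hw⟩ := (h.eq_message_iff (by omega)).1 hm
    rw [phaseAction_odd hL] at hr
    split_ifs at hr with h₁ h₂ h₃
    obtain ⟨hr', u, hu, huw⟩ := (h.heard_even_iff hL).1 h₃
    have hτv : τ v = ((τ v).1, true) := Prod.ext rfl hs
    have huv : v = u := by
      by_contra hne
      exact huw v hne hτv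
    subst huv
    refine ⟨r, hτv, hr', fun w hwv hwr hwk => ?_⟩
    have hnone := hw w hwr
    have hτw : τ w = ((τ v).1, false) := by
      refine Prod.ext hwk ?_
      by_contra hne
      exact huw w hwv (Prod.ext hwk (by simpa using hne))
    have hheard : (o w (2 * (τ v).1)).heard = true := (h.heard_even_iff hL).2 ⟨hτw, v, hτv, huw⟩
    rw [phaseAction_odd hL, hτw] at hnone
    simp [hheard] at hnone
  · rintro ⟨hL, r, hv, hr, hw⟩
    have hs : (τ v).2 = true := by rw [hv]
    refine ⟨⟨hs, hL⟩, Feedback.heard_iff.2 ⟨0, (h.eq_message_iff (by omega)).2 ⟨?_, r, ?_, ?_⟩⟩⟩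
    · simp [phaseAction_odd hL, hs]
    · have hheard : (o r (2 * (τ v).1)).heard = true := by
        refine (h.heard_even_iff hL).2 ⟨hr, v, hv, fun w hwv hτw => ?_⟩
        by_cases hwr : w = r
        · subst hwr
          simp [hr] at hτw
        · exact hw w hwv hwr (by rw [hτw])
      rw [phaseAction_odd hL, hr]
      simp [hheard]
    · intro w hwr
      rw [phaseAction_odd hL]
      by_cases hwv : w = v
      · subst hwv
        simp [hs]
      · simp [(hw w hwv hwr).symm]

/-- In this round winners transmit and all others listen, so the channel itself tests whether the
winner is unique. -/
theorem IsPhase.announce_eq_message_iff (h : IsPhase L τ o) {v : Fin n} {m : ℕ} :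
    o v (2 * L) = .message m ↔ ∃ u, v ≠ u ∧ (τ u).1 = m ∧ winner L (τ u) (o u) = true ∧
      ∀ w, w ≠ u → winner L (τ w) (o w) = false := by
  rw [h.eq_message_iff (by omega)]
  simp only [phaseAction_announce]
  constructor
  · rintro ⟨hv, u, hu, hw⟩
    refine ⟨u, ?_, ?_, ?_, fun w hwu => ?_⟩
    · rintro rfl
      rw [hv] at hu
      cases hu
    · split_ifs at hu with h₁
      simpa using hu
    · split_ifs at hu with h₁
      exact h₁
    · by_contra hne
      have := hw w hwu
      rw [if_pos (by simpa using hne)] at this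
      cases this
  · rintro ⟨u, hvu, rfl, hu, hw⟩
    exact ⟨by simp [hw v hvu], u, by simp [hu], fun w hwu => by simp [hw w hwu]⟩

/-- A phase with a unique winner ends with the election of this winner. -/
theorem IsPhase.outcome_of_unique_winner (h : IsPhase L τ o) {u : Fin n}
    (hu : winner L (τ u) (o u) = true) (hw : ∀ w, w ≠ u → winner L (τ w) (o w) = false) :
    (phaseAction L (τ u) (o u) (2 * L + 2) = .transmit 0 ∧ phaseOutput L (o u) = some .leader) ∧
      ∀ v, v ≠ u → phaseAction L (τ v) (o v) (2 * L + 2) = .listen ∧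
        phaseOutput L (o v) = some .nonLeader := by
  obtain ⟨hL, r, hτu, hτr, hτw⟩ := h.winner_iff.1 hu
  have hmsg : ∀ v, v ≠ u → o v (2 * L) = .message (τ u).1 := fun v hv =>
    h.announce_eq_message_iff.2 ⟨u, hv, rfl, hu, hw⟩
  have hru : r ≠ u := by
    rintro rfl
    rw [hτu] at hτr
    simp at hτr
  -- The winner's partner `r` is the only device apart from the winner in that slot, so its
  -- confirmation cannot collide.
  have hack : o u (2 * L + 1) = .message 0 := by
    refine (h.eq_message_iff (by omega)).2 ⟨?_, r, ?_, fun w hwr => ?_⟩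
    · simp [phaseAction_confirm, hu]
    · rw [phaseAction_confirm, if_neg (by simp [hw r hru]),
        if_pos ⟨by rw [hτr], by rw [hmsg r hru, hτr]⟩]
    · rw [phaseAction_confirm]
      by_cases hwu : w = u
      · subst hwu
        simp [hu]
      · simp [hw w hwu, hmsg w hwu, (hτw w hwu hwr).symm]
  have hnack : ∀ v, v ≠ u → (o v (2 * L + 1)).heard = false := by
    intro v hv
    by_contra hne
    obtain ⟨m, hm⟩ := Feedback.heard_iff.1 (by simpa using hne)
    have := ((h.eq_message_iff (by omega)).1 hm).1
    rw [phaseAction_confirm, if_neg (by simp [hw v hv])] at this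
    split_ifs at this
  refine ⟨?_, fun v hv => ?_⟩
  · rw [phaseAction_last, phaseOutput]
    simp [hack]
  · rw [phaseAction_last, phaseOutput]
    simp [hnack v hv, hmsg v hv]

/-- Soundness: every decision goes back to an announcement heard by someone, either the deciding
device or the device that confirmed, and only a unique winner's announcement can be heard. -/
theorem IsPhase.exists_unique_winner (h : IsPhase L τ o) {v : Fin n}
    (hv : phaseOutput L (o v) ≠ none) :
    ∃ u, winner L (τ u) (o u) = true ∧ ∀ w, w ≠ u → winner L (τ w) (o w) = false := by
  have key : ∀ (x : Fin n) (m : ℕ), o x (2 * L) = .message m →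
      ∃ u, winner L (τ u) (o u) = true ∧ ∀ w, w ≠ u → winner L (τ w) (o w) = false := by
    intro x m hx
    obtain ⟨u, -, -, hu, hw⟩ := h.announce_eq_message_iff.1 hx
    exact ⟨u, hu, hw⟩
  unfold phaseOutput at hv
  split_ifs at hv with h₁ h₂
  · obtain ⟨m, hm⟩ := Feedback.heard_iff.1 h₁
    obtain ⟨-, x, hx, -⟩ := (h.eq_message_iff (by omega)).1 hm
    rw [phaseAction_confirm] at hx
    split_ifs at hx with h₃ h₄
    exact key x _ h₄.2
  · obtain ⟨m, hm⟩ := Feedback.heard_iff.1 h₂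
    exact key v m hm
  · exact absurd rfl hv

theorem IsPhase.unique_winner_of_good (h : IsPhase L τ o) (hg : GoodTickets L τ) :
    ∃ u, winner L (τ u) (o u) = true ∧ ∀ w, w ≠ u → winner L (τ w) (o w) = false := by
  obtain ⟨k, hk, s, r, hsr, hno⟩ := hg
  have hk' : (τ s).1 = k := by rw [hsr.1]
  refine ⟨s, h.winner_iff.2 ⟨hk' ▸ hk, r, hk' ▸ hsr⟩, fun w hws => ?_⟩
  by_contra hne
  obtain ⟨hL, r', hwr⟩ := h.winner_iff.1 (by simpa using hne)
  by_cases hwk : (τ w).1 = k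
  · by_cases hwr' : w = r
    · subst hwr'
      have h₁ := hwr.1
      rw [hsr.2.1] at h₁
      simp at h₁
    · exact hsr.2.2 w hws hwr' hwk
  · exact hno _ hL hwk _ _ hwr

/-- In a phase, a device is active only in its slot and in the last three rounds. -/
theorem active_rounds_subset (σ : ℕ × Bool) {p : ℕ} (hp : p < 2 * L + 3) {f : ℕ → Feedback}
    (h : phaseAction L σ f p ≠ .idle) :
    p ∈ ({2 * σ.1, 2 * σ.1 + 1, 2 * L, 2 * L + 1, 2 * L + 2} : Finset ℕ) := by
  simp only [Finset.mem_insert, Finset.mem_singleton]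
  by_cases h₁ : p < 2 * L
  · by_cases h₂ : p / 2 = σ.1
    · omega
    · simp [phaseAction, h₁, h₂] at h
  · omega

end Phase

/-! ### Random tickets and the schedule of phases -/

/-- The ticket drawn with the random bits `b` for a phase with `L` slots: slot `k < L` is drawn with
probability `2⁻¹ ^ (k + 1)`, and a device becomes a sender with probability `2⁻¹ ^ 10`. -/
noncomputable def ticket (L : ℕ) (b : ℕ → Bool) : ℕ × Bool :=
  -- The value `L` means that no slot is drawn. The sender flag uses the first ten bits and the slot
  -- uses later ones, which makes the two independent.
  (Nat.find (p := fun i => b (10 + i) = true ∨ L ≤ i) ⟨L, Or.inr le_rfl⟩,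
    decide (∀ i : Fin 10, b i = true))

theorem measurableSet_bit (i : ℕ) (c : Bool) : MeasurableSet {b : ℕ → Bool | b i = c} :=
  measurableSet_eq_fun (measurable_pi_apply i) measurable_const

theorem measurable_ticket (L : ℕ) : Measurable (ticket L) := by
  refine Measurable.prodMk ?_ ?_
  · refine measurable_find _ fun k => ?_
    exact (measurableSet_bit _ _).union (MeasurableSet.const _)
  · refine measurable_to_bool ?_
    have : (fun b : ℕ → Bool => decide (∀ i : Fin 10, b i = true)) ⁻¹' {true} =
        ⋂ i : Fin 10, {b : ℕ → Bool | b i = true} := by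
      ext b
      simp
    rw [this]
    exact MeasurableSet.iInter fun i => measurableSet_bit _ _

/-- The random bits used in phase `j`. -/
def phaseBits (r : Seed) (j : ℕ) : ℕ → Bool := fun i => r (Nat.pair j i)

theorem measurable_phaseBits (j : ℕ) : Measurable fun r : Seed => phaseBits r j :=
  measurable_pi_lambda _ fun _ => measurable_pi_apply _

/-- The first round of phase `j`, if phase `j` has `L j` slots. -/
def phaseStart (L : ℕ → ℕ) : ℕ → ℕ
  | 0 => 0
  | j + 1 => phaseStart L j + (2 * L j + 3)

/-- The phase to which round `t` belongs. -/
def phaseOf (L : ℕ → ℕ) (t : ℕ) : ℕ := Nat.findGreatest (fun j => phaseStart L j ≤ t) t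

/-- The observation in round `i`. -/
def obs (h : List Feedback) (i : ℕ) : Feedback := h.reverse.getD i .nothing

section PhaseStart

variable {L : ℕ → ℕ}

theorem phaseStart_strictMono : StrictMono (phaseStart L) :=
  strictMono_nat_of_lt_succ fun j => by simp only [phaseStart]; omega

theorem phaseOf_eq {j t : ℕ} (h₁ : phaseStart L j ≤ t) (h₂ : t < phaseStart L (j + 1)) :
    phaseOf L t = j := by
  refine (Nat.findGreatest_eq_iff).2 ⟨?_, fun _ => h₁, fun {i} hi _ => ?_⟩
  · exact (phaseStart_strictMono.le_apply).trans h₁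
  · exact not_le.2 (h₂.trans_le (phaseStart_strictMono.monotone hi))

end PhaseStart

/-- The leader election algorithm whose phase `j` has `L j` slots. -/
noncomputable def election (L : ℕ → ℕ) : Algorithm where
  action r h :=
    phaseAction (L (phaseOf L h.length))
      (ticket (L (phaseOf L h.length)) (phaseBits r (phaseOf L h.length)))
      (fun i => obs h (phaseStart L (phaseOf L h.length) + i))
      (h.length - phaseStart L (phaseOf L h.length))
  output _ h :=
    -- The last completed round `h.length - 1` identifies the phase. On the empty history the
    -- subtraction truncates to 0 and the test fails, since phase 0 has at least three rounds.
    if h.length = phaseStart L (phaseOf L (h.length - 1) + 1) then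
      phaseOutput (L (phaseOf L (h.length - 1)))
        (fun i => obs h (phaseStart L (phaseOf L (h.length - 1)) + i))
    else none
  measurable_action h := by
    refine (measurable_from_top (f := fun σ : ℕ × Bool => phaseAction _ σ _ _)).comp ?_
    have := (measurable_ticket (L (phaseOf L h.length))).comp
      (measurable_phaseBits (phaseOf L h.length))
    simp only [Function.comp_def] at this
    convert this
    exact (top_unique fun s _ => (Set.to_countable s).measurableSet).symm
  measurable_output _ := measurable_const

/-! ### From executions to phases; time and energy in terms of tickets -/

section Execution

variable {n : ℕ} (L : ℕ → ℕ) (ω : Fin n → Seed)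

/-- The tickets of all devices in phase `j`. -/
noncomputable def tickets (j : ℕ) : Fin n → ℕ × Bool :=
  fun v => ticket (L j) (phaseBits (ω v) j)

/-- The feedback of all devices in round `t`. -/
noncomputable def feedbackAt (t : ℕ) : Fin n → Feedback :=
  feedback fun w => (election L).actionAt ω t w

/-- No device has terminated before round `t`. -/
def RunningBefore (t : ℕ) : Prop := ∀ s < t, ∀ v, (election L).outputAt ω s v = none

variable {L ω}

theorem history_succ_of_running {A : Algorithm} {t : ℕ} {v : Fin n}
    (h : A.outputAt ω t v = none) :
    A.history ω (t + 1) v =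
      feedback (fun w => A.actionAt ω t w) v :: A.history ω t v := by
  unfold Algorithm.outputAt at h
  simp [Algorithm.history, h, Algorithm.actionAt]

theorem history_succ_of_terminated {A : Algorithm} {t : ℕ} {v : Fin n}
    (h : A.outputAt ω t v ≠ none) : A.history ω (t + 1) v = A.history ω t v := by
  unfold Algorithm.outputAt at h
  obtain ⟨x, hx⟩ := Option.ne_none_iff_exists'.1 h
  simp [Algorithm.history, hx]

theorem outputAt_ne_none_of_le {A : Algorithm} {s t : ℕ} {v : Fin n} (hst : s ≤ t)
    (h : A.outputAt ω s v ≠ none) : A.outputAt ω t v ≠ none := by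
  induction t, hst using Nat.le_induction with
  | base => exact h
  | succ t _ ih =>
    have : A.outputAt ω (t + 1) v = A.outputAt ω t v := by
      unfold Algorithm.outputAt
      rw [history_succ_of_terminated ih]
    rwa [this]

theorem actionAt_of_terminated {A : Algorithm} {t : ℕ} {v : Fin n}
    (h : A.outputAt ω t v ≠ none) : A.actionAt ω t v = .idle := by
  unfold Algorithm.outputAt at h
  obtain ⟨x, hx⟩ := Option.ne_none_iff_exists'.1 h
  simp [Algorithm.actionAt, Algorithm.move, hx]

theorem actionAt_of_running {A : Algorithm} {t : ℕ} {v : Fin n}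
    (h : A.outputAt ω t v = none) : A.actionAt ω t v = A.action (ω v) (A.history ω t v) := by
  unfold Algorithm.outputAt at h
  simp [Algorithm.actionAt, Algorithm.move, h]

theorem history_eq_of_running {A : Algorithm} {t : ℕ} {v : Fin n}
    (h : ∀ s < t, A.outputAt ω s v = none) :
    A.history ω t v =
      ((List.range t).map fun s => feedback (fun w => A.actionAt ω s w) v).reverse := by
  induction t with
  | zero => rfl
  | succ t ih =>
    rw [history_succ_of_running (h t t.lt_succ_self), ih fun s hs => h s (hs.trans t.lt_succ_self)]
    simp [List.range_succ]

theorem length_history_of_running {A : Algorithm} {t : ℕ} {v : Fin n}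
    (h : ∀ s < t, A.outputAt ω s v = none) : (A.history ω t v).length = t := by
  simp [history_eq_of_running h]

theorem obs_history_of_running {A : Algorithm} {t i : ℕ} {v : Fin n}
    (h : ∀ s < t, A.outputAt ω s v = none) :
    obs (A.history ω t v) i =
      if i < t then feedback (fun w => A.actionAt ω i w) v else .nothing := by
  rw [history_eq_of_running h, obs, List.reverse_reverse]
  split_ifs with hi <;> simp [List.getD_eq_getElem?_getD, hi]

/-- Actions in round `p` of a phase depend only on observations in earlier rounds. -/
theorem phaseAction_congr {l : ℕ} {σ : ℕ × Bool} {f g : ℕ → Feedback} {p : ℕ}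
    (h : ∀ i < p, f i = g i) : phaseAction l σ f p = phaseAction l σ g p := by
  by_cases h₁ : p < 2 * l
  · by_cases h₂ : p % 2 = 0
    · simp [phaseAction, h₁, h₂]
    · simp [phaseAction, h₁, h (p - 1) (by omega)]
  · have hw : winner l σ f = winner l σ g := by
      unfold winner
      by_cases hσ : σ.1 < l
      · rw [h (2 * σ.1 + 1) (by omega)]
      · simp [hσ]
    rcases Nat.lt_trichotomy p (2 * l + 1) with hp | hp | hp
    · obtain rfl : p = 2 * l := by omega
      simp [phaseAction, hw]
    · simp [phaseAction, hp, hw, h (2 * l) (by omega)]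
    · have h₂ : p ≠ 2 * l := by omega
      simp [phaseAction, h₁, h₂, hp.ne', h (2 * l) (by omega), h (2 * l + 1) hp]

theorem phaseOutput_congr {l : ℕ} {f g : ℕ → Feedback}
    (h : ∀ i < 2 * l + 3, f i = g i) : phaseOutput l f = phaseOutput l g := by
  unfold phaseOutput
  rw [h (2 * l + 1) (by omega), h (2 * l) (by omega)]

theorem election_actionAt {j p t : ℕ} (hp : p < 2 * L j + 3) (ht : t = phaseStart L j + p)
    (h : RunningBefore L ω (t + 1)) (v : Fin n) :
    (election L).actionAt ω t v =
      phaseAction (L j) (tickets L ω j v) (fun i => feedbackAt L ω (phaseStart L j + i) v) p := by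
  have hrun : ∀ s < t, (election L).outputAt ω s v = none := fun s hs => h s (by omega) v
  have hj : phaseOf L t = j := phaseOf_eq (by omega) (by simp only [phaseStart]; omega)
  have hlen := length_history_of_running hrun
  have hp' : t - phaseStart L j = p := by omega
  rw [actionAt_of_running (h t (by omega) v)]
  change phaseAction (L (phaseOf L ((election L).history ω t v).length)) _ _ _ = _
  rw [hlen, hj, hp']
  refine phaseAction_congr fun i hi => ?_
  rw [obs_history_of_running hrun, if_pos (by omega)]
  rfl

theorem election_output_of_running {t : ℕ} {v : Fin n}
    (h : ∀ s < t, (election L).outputAt ω s v = none) :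
    (election L).outputAt ω t v =
      if t = phaseStart L (phaseOf L (t - 1) + 1) then phaseOutput (L (phaseOf L (t - 1)))
        (fun i => obs ((election L).history ω t v) (phaseStart L (phaseOf L (t - 1)) + i))
      else none := by
  have hlen := length_history_of_running h
  change (if ((election L).history ω t v).length = _ then _ else _) = _
  rw [hlen]

theorem election_outputAt_end {j : ℕ} (h : RunningBefore L ω (phaseStart L (j + 1))) (v : Fin n) :
    (election L).outputAt ω (phaseStart L (j + 1)) v =
      phaseOutput (L j) (fun i => feedbackAt L ω (phaseStart L j + i) v) := by
  have hrun : ∀ s < phaseStart L (j + 1), (election L).outputAt ω s v = none :=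
    fun s hs => h s hs v
  have hstart : phaseStart L (j + 1) = phaseStart L j + (2 * L j + 3) := rfl
  have hj : phaseOf L (phaseStart L (j + 1) - 1) = j := phaseOf_eq (by omega) (by omega)
  rw [election_output_of_running hrun, hj, if_pos rfl]
  refine phaseOutput_congr fun i hi => ?_
  rw [obs_history_of_running hrun, if_pos (by omega)]
  rfl

/-- This transfers the analysis of an isolated phase to the actual execution, as long as nobody has
stopped before the phase ends. -/
theorem isPhase_of_running {j : ℕ} (h : RunningBefore L ω (phaseStart L (j + 1))) :
    IsPhase (L j) (tickets L ω j) (fun v i => feedbackAt L ω (phaseStart L j + i) v) := by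
  intro p hp v
  have ht : phaseStart L j + p < phaseStart L (j + 1) := by simp only [phaseStart]; omega
  have hact := fun w => election_actionAt hp rfl (fun s hs => h s (by omega)) w
  simp only [← hact]
  rfl

theorem electedAt_of_unique_winner {j : ℕ} (h : RunningBefore L ω (phaseStart L (j + 1)))
    (hu : ∃ u, winner (L j) (tickets L ω j u)
        (fun i => feedbackAt L ω (phaseStart L j + i) u) = true ∧
      ∀ w, w ≠ u → winner (L j) (tickets L ω j w)
        (fun i => feedbackAt L ω (phaseStart L j + i) w) = false) :
    ∃ u, (election L).ElectedAt ω (phaseStart L j + (2 * L j + 2)) u := by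
  obtain ⟨u, hu, hw⟩ := hu
  obtain ⟨⟨h₁, h₂⟩, h₃⟩ := (isPhase_of_running h).outcome_of_unique_winner hu hw
  have hstart : phaseStart L (j + 1) = phaseStart L j + (2 * L j + 2) + 1 := rfl
  have hact := election_actionAt (p := 2 * L j + 2) (by omega) rfl (hstart ▸ h)
  have hout := election_outputAt_end h
  rw [hstart] at hout
  refine ⟨u, fun v => h _ (by omega) v, ⟨0, (hact u).trans h₁⟩, fun v hv => ?_,
    (hout u).trans h₂, fun v hv => ?_⟩
  · exact (hact v).trans (h₃ v hv).1
  · exact (hout v).trans (h₃ v hv).2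

/-- The algorithm never errs. -/
theorem exists_electedAt_of_terminated {t : ℕ} {v : Fin n}
    (h : (election L).outputAt ω t v ≠ none) : ∃ s < t, ∃ u, (election L).ElectedAt ω s u := by
  classical
  -- Consider the first time at which any device has terminated. It is the end of a phase through
  -- which all devices were running.
  have hex : ∃ t v, (election L).outputAt ω t v ≠ none := ⟨t, v, h⟩
  have hle : Nat.find hex ≤ t := Nat.find_min' hex ⟨v, h⟩
  obtain ⟨w, hw⟩ := Nat.find_spec hex
  have hrun : RunningBefore L ω (Nat.find hex) := by
    intro s hs x
    by_contra hne
    exact Nat.find_min hex hs ⟨x, hne⟩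
  generalize Nat.find hex = s at hle hw hrun
  have hout := election_output_of_running fun r hr => hrun r hr w
  have hs : s = phaseStart L (phaseOf L (s - 1) + 1) := by
    by_contra hne
    rw [if_neg hne] at hout
    exact hw hout
  generalize phaseOf L (s - 1) = j at hs
  subst hs
  rw [election_outputAt_end hrun] at hw
  obtain ⟨u, hu⟩ := electedAt_of_unique_winner hrun ((isPhase_of_running hrun).exists_unique_winner hw)
  have hstart : phaseStart L (j + 1) = phaseStart L j + (2 * L j + 2) + 1 := rfl
  exact ⟨_, by omega, u, hu⟩

theorem outputAt_succ_ne_none_of_electedAt {A : Algorithm} {t : ℕ} {u : Fin n}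
    (h : A.ElectedAt ω t u) (v : Fin n) : A.outputAt ω (t + 1) v ≠ none := by
  obtain ⟨-, -, -, h₁, h₂⟩ := h
  by_cases hv : v = u
  · rw [hv, h₁]
    simp
  · rw [h₂ v hv]
    simp

/-- All devices have terminated at the end of a phase with good tickets. -/
theorem terminated_of_good {j t : ℕ} (hg : GoodTickets (L j) (tickets L ω j))
    (ht : phaseStart L (j + 1) ≤ t) (v : Fin n) : (election L).outputAt ω t v ≠ none := by
  refine outputAt_ne_none_of_le ht ?_
  by_cases hrun : RunningBefore L ω (phaseStart L (j + 1))
  · obtain ⟨u, hu⟩ := electedAt_of_unique_winner hrun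
      ((isPhase_of_running hrun).unique_winner_of_good hg)
    exact outputAt_succ_ne_none_of_electedAt hu v
  -- If some device stopped earlier, it did so through an election, which stopped all devices.
  · simp only [RunningBefore, not_forall] at hrun
    obtain ⟨s, hs, w, hw⟩ := hrun
    obtain ⟨r, hr, u, hu⟩ := exists_electedAt_of_terminated hw
    exact outputAt_ne_none_of_le (by omega) (outputAt_succ_ne_none_of_electedAt hu v)

/-- The tickets of the first `j` phases are not good. -/
def NoGoodBefore (L : ℕ → ℕ) (ω : Fin n → Seed) (j : ℕ) : Prop :=
  ∀ i < j, ¬ GoodTickets (L i) (tickets L ω i)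

theorem terminated_of_not_noGoodBefore {j t : ℕ} (h : ¬ NoGoodBefore L ω j)
    (ht : phaseStart L j ≤ t) (v : Fin n) : (election L).outputAt ω t v ≠ none := by
  simp only [NoGoodBefore, not_forall, not_not] at h
  obtain ⟨i, hi, hg⟩ := h
  exact terminated_of_good hg ((phaseStart_strictMono.monotone hi).trans ht) v

theorem phaseStart_eq_sum (j : ℕ) : phaseStart L j = ∑ i ∈ Finset.range j, (2 * L i + 3) := by
  induction j with
  | zero => rfl
  | succ j ih => rw [Finset.sum_range_succ, ← ih]; rfl

open scoped Classical in
-- Phase `j` is charged only if all earlier tickets failed. This event refers to tickets alone,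
-- which are defined even after termination, so independence applies to it directly.
theorem time_le :
    (election L).time ω ≤
      ∑' j, if NoGoodBefore L ω j then ((2 * L j + 3 : ℕ) : ℝ≥0∞) else 0 := by
  by_cases hall : ∀ j, NoGoodBefore L ω j
  · have : ∑' j, (if NoGoodBefore L ω j then ((2 * L j + 3 : ℕ) : ℝ≥0∞) else 0) = ∞ := by
      refine top_unique ?_
      rw [← ENNReal.tsum_const_eq_top_of_ne_zero (α := ℕ) one_ne_zero]
      refine ENNReal.tsum_le_tsum fun j => ?_
      rw [if_pos (hall j)]
      exact_mod_cast (by omega : 1 ≤ 2 * L j + 3)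
    rw [this]
    exact le_top
  · simp only [not_forall] at hall
    have hle : ∀ i < Nat.find hall, NoGoodBefore L ω i := fun i hi => by
      simpa using Nat.find_min hall hi
    have hterm := fun v => terminated_of_not_noGoodBefore (Nat.find_spec hall) le_rfl v
    refine (iInf₂_le _ hterm).trans ?_
    rw [phaseStart_eq_sum, Nat.cast_sum]
    refine le_trans (Finset.sum_le_sum fun i hi => ?_) (ENNReal.sum_le_tsum _)
    rw [if_pos (hle i (Finset.mem_range.1 hi))]

theorem exists_phaseAction_of_active {j p : ℕ} {v : Fin n} (hp : p < 2 * L j + 3)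
    (h : (election L).actionAt ω (phaseStart L j + p) v ≠ .idle) :
    ∃ f, phaseAction (L j) (tickets L ω j v) f p ≠ .idle := by
  have hout : (election L).outputAt ω (phaseStart L j + p) v = none := by
    by_contra hne
    exact h (actionAt_of_terminated hne)
  have hrun : ∀ s < phaseStart L j + p, (election L).outputAt ω s v = none := by
    intro s hs
    by_contra hne
    exact outputAt_ne_none_of_le hs.le hne hout
  have hj : phaseOf L (phaseStart L j + p) = j :=
    phaseOf_eq (by omega) (by simp only [phaseStart]; omega)
  rw [actionAt_of_running hout] at h
  change phaseAction (L (phaseOf L ((election L).history ω _ v).length)) _ _ _ ≠ _ at h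
  rw [length_history_of_running hrun, hj, Nat.add_sub_cancel_left] at h
  exact ⟨_, h⟩

open scoped Classical in
-- After a good phase everyone is idle; otherwise only the two rounds of the device's slot and the
-- last three rounds count.
theorem phase_energy_le (j : ℕ) (v : Fin n) :
    ∑ p ∈ Finset.range (2 * L j + 3),
        (if (election L).actionAt ω (phaseStart L j + p) v = .idle then 0 else 1 : ℝ≥0∞) ≤
      if NoGoodBefore L ω j then 5 else 0 := by
  split_ifs with hg
  · set s : Finset ℕ := {2 * (tickets L ω j v).1, 2 * (tickets L ω j v).1 + 1, 2 * L j,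
      2 * L j + 1, 2 * L j + 2}
    calc _ ≤ ∑ p ∈ Finset.range (2 * L j + 3), (if p ∈ s then 1 else 0 : ℝ≥0∞) := by
          refine Finset.sum_le_sum fun p hp => ?_
          have hp' := Finset.mem_range.1 hp
          split_ifs with h₁ h₂ h₂
          · exact zero_le
          · exact le_rfl
          · exact le_rfl
          · obtain ⟨f, hf⟩ := exists_phaseAction_of_active hp' h₁
            exact absurd (active_rounds_subset _ hp' hf) h₂
      _ = ((Finset.range (2 * L j + 3)).filter (· ∈ s)).card := by
          rw [Finset.sum_boole]
      _ ≤ (s.card : ℝ≥0∞) := by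
          refine Nat.cast_le.2 (Finset.card_le_card fun x hx => (Finset.mem_filter.1 hx).2)
      _ ≤ 5 := by exact_mod_cast Finset.card_le_five
  · refine le_of_eq (Finset.sum_eq_zero fun p _ => if_pos ?_)
    exact actionAt_of_terminated (terminated_of_not_noGoodBefore hg (by omega) v)

theorem sum_range_phaseStart (f : ℕ → ℝ≥0∞) (j : ℕ) :
    ∑ t ∈ Finset.range (phaseStart L j), f t =
      ∑ i ∈ Finset.range j, ∑ p ∈ Finset.range (2 * L i + 3), f (phaseStart L i + p) := by
  induction j with
  | zero => rfl
  | succ j ih => rw [Finset.sum_range_succ, ← ih, phaseStart, Finset.sum_range_add]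

open scoped Classical in
theorem energy_le :
    (election L).energy ω ≤ ∑' j, if NoGoodBefore L ω j then (5 : ℝ≥0∞) else 0 := by
  refine iSup_le fun v => ?_
  rw [Algorithm.deviceEnergy, ENNReal.tsum_eq_iSup_nat]
  refine iSup_le fun N => ?_
  -- Since `N ≤ phaseStart L N`, the first `N` rounds lie within the first `N` phases.
  refine (Finset.sum_le_sum_of_subset
    (Finset.range_mono (phaseStart_strictMono (L := L).le_apply))).trans ?_
  rw [sum_range_phaseStart]
  exact (Finset.sum_le_sum fun j _ => phase_energy_le j v).trans (ENNReal.sum_le_tsum _)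

end Execution

/-! ### Numerical estimates -/

section Numeric

theorem nat_mul_pow_mul_sub_le {a b : ℝ} (hb : 0 ≤ b) (hab : b ≤ a) (N : ℕ) :
    N * b ^ (N - 1) * (a - b) ≤ a ^ N - b ^ N := by
  rcases Nat.eq_zero_or_pos N with rfl | hN
  · simp
  rw [← geom_sum₂_mul a b N]
  refine mul_le_mul_of_nonneg_right ?_ (by linarith)
  calc (N : ℝ) * b ^ (N - 1) = ∑ i ∈ Finset.range N, b ^ (N - 1) := by simp
    _ ≤ _ := by
      refine Finset.sum_le_sum fun i hi => ?_
      have hi' := Finset.mem_range.1 hi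
      calc b ^ (N - 1) = b ^ i * b ^ (N - 1 - i) := by
            rw [← pow_add]; congr 1; omega
        _ ≤ a ^ i * b ^ (N - 1 - i) := by gcongr

/-- With `B = N * (1 - x) ^ (N - 1) * x` and `Δ` the difference on the right, the left side is at
most `8 * B ^ 2`, while `B ≤ 2 * Δ` and `Δ ≤ 1`. At `x = 2⁻¹ ^ (k + 2)` the right side telescopes in
`k`, which gives a bound free of `N`. -/
theorem pair_prob_le (N : ℕ) {x : ℝ} (hx₀ : 0 ≤ x) (hx : x ≤ 1 / 4) :
    ((N * (N - 1) : ℕ) : ℝ) * (2 * x) ^ 2 * (1 - 2 * x) ^ (N - 2) ≤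
      32 * ((1 - x / 2) ^ N - (1 - x) ^ N) := by
  have hΔ := nat_mul_pow_mul_sub_le (a := 1 - x / 2) (b := 1 - x) (by linarith) (by linarith) N
  set Δ := (1 - x / 2) ^ N - (1 - x) ^ N with hΔdef
  have hΔ₁ : Δ ≤ 1 := by
    have h₁ : (1 - x / 2) ^ N ≤ 1 := pow_le_one₀ (by linarith) (by linarith)
    have h₂ : 0 ≤ (1 - x) ^ N := pow_nonneg (by linarith) _
    linarith
  have hB₀ : 0 ≤ (N : ℝ) * (1 - x) ^ (N - 1) * x := by
    have : 0 ≤ 1 - x := by linarith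
    positivity
  have hB : (N : ℝ) * (1 - x) ^ (N - 1) * x ≤ 2 * Δ := by linarith
  have hΔ₀ : 0 ≤ Δ := by linarith
  rcases lt_or_ge N 2 with hN | hN
  · have : N * (N - 1) = 0 := by interval_cases N <;> rfl
    rw [this]
    simp only [Nat.cast_zero, zero_mul]
    positivity
  -- Use `1 - 2 * x ≤ (1 - x) ^ 2`; the factor 2 pays for the two missing powers of `1 - x`, as `(1
  -- - x) ^ 2 ≥ 9 / 16`.
  have h₁ : (1 - 2 * x) ^ (N - 2) ≤ 2 * ((1 - x) ^ (N - 1)) ^ 2 := by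
    have h₃ : (1 - 2 * x) ^ (N - 2) ≤ ((1 - x) ^ 2) ^ (N - 2) :=
      pow_le_pow_left₀ (by linarith) (by nlinarith) _
    have h₄ : ((1 - x) ^ (N - 1)) ^ 2 = ((1 - x) ^ 2) ^ (N - 2) * (1 - x) ^ 2 := by
      rw [← pow_mul, ← pow_mul, ← pow_add]; congr 1; omega
    have h₅ : 1 ≤ 2 * (1 - x) ^ 2 := by nlinarith
    have h₆ : 0 ≤ ((1 - x) ^ 2) ^ (N - 2) := by positivity
    rw [h₄]
    nlinarith
  have h₂ : ((N * (N - 1) : ℕ) : ℝ) ≤ (N : ℝ) ^ 2 := by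
    rw [sq]
    exact_mod_cast Nat.mul_le_mul_left N (Nat.sub_le N 1)
  calc ((N * (N - 1) : ℕ) : ℝ) * (2 * x) ^ 2 * (1 - 2 * x) ^ (N - 2)
      ≤ (N : ℝ) ^ 2 * (2 * x) ^ 2 * (2 * ((1 - x) ^ (N - 1)) ^ 2) := by
        have : 0 ≤ 1 - 2 * x := by linarith
        gcongr
    _ = 8 * ((N : ℝ) * (1 - x) ^ (N - 1) * x) ^ 2 := by ring
    _ ≤ 8 * (2 * Δ) ^ 2 := by gcongr
    _ ≤ 32 * Δ := by nlinarith

/-- The expected number of ordered pairs of devices that are alone in their slot is bounded. -/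
theorem sum_pair_prob_le (N L : ℕ) :
    ∑ k ∈ Finset.range L, ((N * (N - 1) : ℕ) : ℝ) * ((2⁻¹ : ℝ) ^ (k + 1)) ^ 2 *
      (1 - (2⁻¹ : ℝ) ^ (k + 1)) ^ (N - 2) ≤ 32 := by
  have hstep : ∀ k ∈ Finset.range L, ((N * (N - 1) : ℕ) : ℝ) * ((2⁻¹ : ℝ) ^ (k + 1)) ^ 2 *
      (1 - (2⁻¹ : ℝ) ^ (k + 1)) ^ (N - 2) ≤
      32 * ((1 - (2⁻¹ : ℝ) ^ (k + 1 + 2)) ^ N - (1 - (2⁻¹ : ℝ) ^ (k + 2)) ^ N) := by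
    intro k _
    have hx : (2⁻¹ : ℝ) ^ (k + 2) ≤ 1 / 4 := by
      rw [pow_add]
      have : (2⁻¹ : ℝ) ^ k ≤ 1 := pow_le_one₀ (by norm_num) (by norm_num)
      linarith
    have := pair_prob_le N (x := (2⁻¹ : ℝ) ^ (k + 2)) (by positivity) hx
    have h₁ : 2 * (2⁻¹ : ℝ) ^ (k + 2) = (2⁻¹ : ℝ) ^ (k + 1) := by ring
    have h₂ : (2⁻¹ : ℝ) ^ (k + 2) / 2 = (2⁻¹ : ℝ) ^ (k + 1 + 2) := by ring
    rwa [h₁, h₂] at this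
  refine (Finset.sum_le_sum hstep).trans ?_
  rw [← Finset.mul_sum, Finset.sum_range_sub fun k => (1 - (2⁻¹ : ℝ) ^ (k + 2)) ^ N]
  have hle : ∀ m : ℕ, (2⁻¹ : ℝ) ^ m ≤ 1 := fun m => pow_le_one₀ (by norm_num) (by norm_num)
  have h₁ : (1 - (2⁻¹ : ℝ) ^ (L + 2)) ^ N ≤ 1 :=
    pow_le_one₀ (by linarith [hle (L + 2)]) (by linarith [show 0 < (2⁻¹ : ℝ) ^ (L + 2) by positivity])
  have h₂ : 0 ≤ (1 - (2⁻¹ : ℝ) ^ (0 + 2)) ^ N := pow_nonneg (by linarith [hle (0 + 2)]) _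
  linarith

/-- Bernoulli's inequality bounds the power with exponent `2 ^ k` below by `1 / 2`; then take fourth
powers. -/
theorem one_sixteenth_le_pow {k n : ℕ} (hn : n ≤ 2 ^ k * 4) :
    1 / 16 ≤ (1 - (2⁻¹ : ℝ) ^ (k + 1)) ^ n := by
  have hq : (2⁻¹ : ℝ) ^ (k + 1) ≤ 1 / 2 := by
    rw [pow_succ]
    have : (2⁻¹ : ℝ) ^ k ≤ 1 := pow_le_one₀ (by norm_num) (by norm_num)
    linarith
  have hhalf : 1 / 2 ≤ (1 - (2⁻¹ : ℝ) ^ (k + 1)) ^ 2 ^ k := by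
    have := one_add_mul_le_pow (a := -(2⁻¹ : ℝ) ^ (k + 1)) (by linarith) (2 ^ k)
    have h₁ : ((2 ^ k : ℕ) : ℝ) * -(2⁻¹ : ℝ) ^ (k + 1) = -(1 / 2) := by
      push_cast
      rw [inv_pow, pow_succ]
      field_simp
    rw [h₁] at this
    simp only [← sub_eq_add_neg] at this
    linarith
  calc (1 / 16 : ℝ) = (1 / 2) ^ 4 := by norm_num
    _ ≤ ((1 - (2⁻¹ : ℝ) ^ (k + 1)) ^ 2 ^ k) ^ 4 := by gcongr
    _ = (1 - (2⁻¹ : ℝ) ^ (k + 1)) ^ (2 ^ k * 4) := by rw [pow_mul]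
    _ ≤ _ := pow_le_pow_of_le_one (by linarith)
        (by linarith [show 0 < (2⁻¹ : ℝ) ^ (k + 1) by positivity]) hn

end Numeric

/-! ### Distribution of the tickets -/

section Law

instance : IsProbabilityMeasure seedMeasure := by
  unfold seedMeasure
  infer_instance

instance (n : ℕ) : IsProbabilityMeasure (seedsMeasure n) := by
  unfold seedsMeasure
  infer_instance

theorem seedMeasure_cylinder (s : Finset ℕ) (c : ℕ → Bool) :
    seedMeasure {b | ∀ i ∈ s, b i = c i} = 2⁻¹ ^ s.card := by
  have hset : {b : Seed | ∀ i ∈ s, b i = c i} = Set.pi s fun i => {c i} := by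
    ext b
    simp [Set.mem_pi]
  rw [hset, seedMeasure, Measure.infinitePi_pi _ fun i _ => measurableSet_singleton _]
  have : ∀ x : Bool, (PMF.uniformOfFintype Bool).toMeasure {x} = 2⁻¹ := by
    intro x
    rw [PMF.toMeasure_apply_singleton _ _ (measurableSet_singleton _)]
    simp
  simp [this]

theorem map_phaseBits (j : ℕ) : seedMeasure.map (fun r => phaseBits r j) = seedMeasure :=
  Measure.map_infinitePi_infinitePi_of_inj (f := fun i => Nat.pair j i)
    fun _ _ h => (Nat.pair_eq_pair.1 h).2

/-- The distribution of a ticket for a phase with `L` slots. -/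
noncomputable def ticketLaw (L : ℕ) : Measure (ℕ × Bool) := seedMeasure.map (ticket L)

instance (L : ℕ) : IsProbabilityMeasure (ticketLaw L) :=
  Measure.isProbabilityMeasure_map (measurable_ticket L).aemeasurable

theorem ticket_fst_eq_iff {L k : ℕ} (hk : k < L) (b : ℕ → Bool) :
    (ticket L b).1 = k ↔ b (10 + k) = true ∧ ∀ i < k, b (10 + i) = false := by
  simp only [ticket, Nat.find_eq_iff, not_or, not_le]
  constructor
  · rintro ⟨h₁, h₂⟩
    exact ⟨h₁.resolve_right (by omega), fun i hi => by simpa using (h₂ i hi).1⟩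
  · rintro ⟨h₁, h₂⟩
    exact ⟨Or.inl h₁, fun i hi => ⟨by simp [h₂ i hi], by omega⟩⟩

theorem ticket_snd_eq_true_iff {L : ℕ} (b : ℕ → Bool) :
    (ticket L b).2 = true ↔ ∀ i < 10, b i = true := by
  simp only [ticket, decide_eq_true_eq]
  exact ⟨fun h i hi => h ⟨i, hi⟩, fun h i => h i i.2⟩

theorem ticketLaw_slot {L k : ℕ} (hk : k < L) :
    (ticketLaw L).real {σ | σ.1 = k} = 2⁻¹ ^ (k + 1) := by
  have hset : ticket L ⁻¹' {σ | σ.1 = k} =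
      {b | ∀ i ∈ Finset.Ico 10 (11 + k), b i = decide (i = 10 + k)} := by
    ext b
    simp only [Set.mem_preimage, Set.mem_ofPred_eq, ticket_fst_eq_iff hk, Finset.mem_Ico]
    constructor
    · rintro ⟨h₁, h₂⟩ i hi
      rcases eq_or_ne i (10 + k) with rfl | hne
      · simpa using h₁
      · have := h₂ (i - 10) (by omega)
        rw [Nat.add_sub_cancel' hi.1] at this
        simp [this, hne]
    · intro h
      exact ⟨by simpa using h (10 + k) (by omega), fun i hi => by
        simpa [hi.ne] using h (10 + i) (by omega)⟩
  rw [Measure.real, ticketLaw, Measure.map_apply (measurable_ticket L) (.of_discrete), hset,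
    seedMeasure_cylinder]
  simp only [Nat.card_Ico, ENNReal.toReal_pow, ENNReal.toReal_inv, ENNReal.toReal_ofNat]
  congr 1
  omega

theorem ticketLaw_sender {L k : ℕ} (hk : k < L) :
    (ticketLaw L).real {(k, true)} = 2⁻¹ ^ 10 * 2⁻¹ ^ (k + 1) := by
  have hset : ticket L ⁻¹' {(k, true)} =
      {b | ∀ i ∈ Finset.range (11 + k), b i = decide (i < 10 ∨ i = 10 + k)} := by
    ext b
    simp only [Set.mem_preimage, Set.mem_singleton_iff, Prod.ext_iff, Set.mem_ofPred_eq,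
      ticket_fst_eq_iff hk, ticket_snd_eq_true_iff, Finset.mem_range]
    constructor
    · rintro ⟨⟨h₁, h₂⟩, h₃⟩ i hi
      rcases lt_or_ge i 10 with hlt | hge
      · simp [h₃ i hlt, hlt]
      rcases eq_or_ne i (10 + k) with rfl | hne
      · simpa using h₁
      · have := h₂ (i - 10) (by omega)
        rw [Nat.add_sub_cancel' hge] at this
        simp [this, hne, hge]
    · intro h
      refine ⟨⟨by simpa using h (10 + k) (by omega), fun i hi => ?_⟩, fun i hi => ?_⟩
      · simpa [hi.ne] using h (10 + i) (by omega)
      · simpa [hi] using h i (by omega)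
  rw [Measure.real, ticketLaw, Measure.map_apply (measurable_ticket L) (.of_discrete), hset,
    seedMeasure_cylinder]
  simp only [Finset.card_range, ENNReal.toReal_pow, ENNReal.toReal_inv, ENNReal.toReal_ofNat]
  rw [← pow_add]
  congr 1
  omega

theorem ticketLaw_receiver {L k : ℕ} (hk : k < L) :
    (ticketLaw L).real {(k, false)} = (1 - 2⁻¹ ^ 10) * 2⁻¹ ^ (k + 1) := by
  have hset : {σ : ℕ × Bool | σ.1 = k} = {(k, true)} ∪ {(k, false)} := by
    ext ⟨a, b⟩
    cases b <;> simp
  have := ticketLaw_slot hk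
  rw [hset, measureReal_union (by simp) (.of_discrete), ticketLaw_sender hk] at this
  linarith

theorem ticketLaw_avoid {L k : ℕ} (hk : k < L) :
    (ticketLaw L).real {σ | σ.1 ≠ k} = 1 - 2⁻¹ ^ (k + 1) := by
  have := probReal_compl_eq_one_sub (μ := ticketLaw L) (s := {σ | σ.1 = k}) (.of_discrete)
  rw [ticketLaw_slot hk] at this
  exact this

theorem ticketLaw_avoid_two {L k k' : ℕ} (hk : k < L) (hk' : k' < L) (hne : k' ≠ k) :
    (ticketLaw L).real {σ | σ.1 ≠ k ∧ σ.1 ≠ k'} = 1 - 2⁻¹ ^ (k + 1) - 2⁻¹ ^ (k' + 1) := by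
  have := probReal_compl_eq_one_sub (μ := ticketLaw L) (s := {σ | σ.1 = k} ∪ {σ | σ.1 = k'})
    (.of_discrete)
  rw [measureReal_union _ (.of_discrete), ticketLaw_slot hk, ticketLaw_slot hk'] at this
  · rw [sub_sub, ← this]
    congr 1
    ext σ
    simp
  · rw [Set.disjoint_left]
    rintro σ rfl h
    exact hne h.symm

theorem map_tickets (n : ℕ) (L : ℕ → ℕ) (j : ℕ) :
    (seedsMeasure n).map (fun ω => tickets L ω j) = Measure.pi fun _ => ticketLaw (L j) := by
  have hm : Measurable fun r => ticket (L j) (phaseBits r j) :=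
    (measurable_ticket (L j)).comp (measurable_phaseBits j)
  have hlaw : seedMeasure.map (fun r => ticket (L j) (phaseBits r j)) = ticketLaw (L j) := by
    rw [ticketLaw, ← map_phaseBits j, Measure.map_map (measurable_ticket (L j))
      (measurable_phaseBits j), map_phaseBits]
    rfl
  rw [← hlaw]
  exact Measure.pi_map_pi fun _ => hm.aemeasurable

end Law

/-! ### A phase with enough slots succeeds with constant probability -/

section GoodProbability

variable {n L : ℕ}

/-- The joint distribution of the tickets of `n` devices. -/
noncomputable abbrev ticketsLaw (n L : ℕ) : Measure (Fin n → ℕ × Bool) :=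
  Measure.pi fun _ => ticketLaw L

theorem prod_eq_of_eq_on_compl (s : Finset (Fin n)) (f : Fin n → ℝ) {c : ℝ}
    (h : ∀ v ∉ s, f v = c) : ∏ v, f v = (∏ v ∈ s, f v) * c ^ (n - s.card) := by
  rw [← Finset.prod_mul_prod_compl s f,
    Finset.prod_congr rfl fun v hv => h v (Finset.mem_compl.1 hv), Finset.prod_const,
    Finset.card_compl, Fintype.card_fin]

theorem ticketsLaw_real_pi (t : Fin n → Set (ℕ × Bool)) :
    (ticketsLaw n L).real (Set.pi Set.univ t) = ∏ v, (ticketLaw L).real (t v) := by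
  simp [Measure.real, Measure.pi_pi, ENNReal.toReal_prod]

theorem PairIn.ne {τ : Fin n → ℕ × Bool} {k : ℕ} {s r : Fin n} (h : PairIn τ k s r) : s ≠ r := by
  rintro rfl
  have := h.1.symm.trans h.2.1
  simp at this

/-- The probability that a device draws a given slot as a sender times the probability that it does
so as a receiver is `pairWeight` times the square of the probability of the slot. -/
noncomputable def pairWeight : ℝ := 2⁻¹ ^ 10 * (1 - 2⁻¹ ^ 10)

/-- The event is a product of one condition per device, so its probability factors. -/
theorem ticketsLaw_pairIn {k : ℕ} (hk : k < L) {s r : Fin n} (hsr : s ≠ r) :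
    (ticketsLaw n L).real {τ | PairIn τ k s r} =
      pairWeight * (2⁻¹ ^ (k + 1)) ^ 2 * (1 - 2⁻¹ ^ (k + 1)) ^ (n - 2) := by
  have hset : {τ : Fin n → ℕ × Bool | PairIn τ k s r} = Set.pi Set.univ fun v =>
      if v = s then {(k, true)} else if v = r then {(k, false)} else {σ | σ.1 ≠ k} := by
    ext τ
    simp only [Set.mem_ofPred_eq, PairIn, Set.mem_pi, Set.mem_univ, true_imp_iff]
    constructor
    · rintro ⟨h₁, h₂, h₃⟩ v
      split_ifs with h₄ h₅
      · simpa [h₄] using h₁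
      · simpa [h₅] using h₂
      · exact h₃ v h₄ h₅
    · intro h
      refine ⟨by simpa using h s, by simpa [hsr.symm] using h r, fun w hs hr => ?_⟩
      simpa [hs, hr] using h w
  rw [hset, ticketsLaw_real_pi, prod_eq_of_eq_on_compl {s, r} _ (c := 1 - 2⁻¹ ^ (k + 1)),
    Finset.prod_pair hsr, Finset.card_pair hsr]
  · simp only [if_true, if_neg hsr.symm, ticketLaw_sender hk, ticketLaw_receiver hk, pairWeight]
    ring
  · intro v hv
    simp only [Finset.mem_insert, Finset.mem_singleton, not_or] at hv
    simp only [if_neg hv.1, if_neg hv.2, ticketLaw_avoid hk]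

theorem ticketsLaw_two_pairs {k k' : ℕ} (hk : k < L) (hk' : k' < L) (hne : k' ≠ k)
    {s r s' r' : Fin n} (hsr : s ≠ r) (hsr' : s' ≠ r') (h₁ : s' ≠ s) (h₂ : s' ≠ r) (h₃ : r' ≠ s)
    (h₄ : r' ≠ r) :
    (ticketsLaw n L).real {τ | PairIn τ k s r ∧ PairIn τ k' s' r'} =
      pairWeight ^ 2 * (2⁻¹ ^ (k + 1)) ^ 2 * (2⁻¹ ^ (k' + 1)) ^ 2 *
        (1 - 2⁻¹ ^ (k + 1) - 2⁻¹ ^ (k' + 1)) ^ (n - 4) := by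
  have hset : {τ : Fin n → ℕ × Bool | PairIn τ k s r ∧ PairIn τ k' s' r'} =
      Set.pi Set.univ fun v => if v = s then {(k, true)} else if v = r then {(k, false)}
        else if v = s' then {(k', true)} else if v = r' then {(k', false)}
        else {σ | σ.1 ≠ k ∧ σ.1 ≠ k'} := by
    ext τ
    simp only [Set.mem_ofPred_eq, PairIn, Set.mem_pi, Set.mem_univ, true_imp_iff]
    constructor
    · rintro ⟨⟨a₁, a₂, a₃⟩, b₁, b₂, b₃⟩ v
      split_ifs with c₁ c₂ c₃ c₄
      · simpa [c₁] using a₁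
      · simpa [c₂] using a₂
      · simpa [c₃] using b₁
      · simpa [c₄] using b₂
      · exact ⟨a₃ v c₁ c₂, b₃ v c₃ c₄⟩
    · intro h
      have hs : τ s = (k, true) := by simpa using h s
      have hr : τ r = (k, false) := by simpa [hsr.symm] using h r
      have hs' : τ s' = (k', true) := by simpa [h₁, h₂] using h s'
      have hr' : τ r' = (k', false) := by simpa [h₃, h₄, hsr'.symm] using h r'
      refine ⟨⟨hs, hr, fun w w₁ w₂ => ?_⟩, hs', hr', fun w w₃ w₄ => ?_⟩
      · by_cases w₃ : w = s'
        · simpa [w₃, hs'] using hne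
        by_cases w₄ : w = r'
        · simpa [w₄, hr'] using hne
        have := h w
        rw [if_neg w₁, if_neg w₂, if_neg w₃, if_neg w₄] at this
        exact this.1
      · by_cases w₁ : w = s
        · simpa [w₁, hs] using hne.symm
        by_cases w₂ : w = r
        · simpa [w₂, hr] using hne.symm
        have := h w
        rw [if_neg w₁, if_neg w₂, if_neg w₃, if_neg w₄] at this
        exact this.2
  have n₁ : s ∉ ({r, s', r'} : Finset (Fin n)) := by simp [hsr, h₁.symm, h₃.symm]
  have n₂ : r ∉ ({s', r'} : Finset (Fin n)) := by simp [h₂.symm, h₄.symm]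
  rw [hset, ticketsLaw_real_pi, prod_eq_of_eq_on_compl {s, r, s', r'} _
    (c := 1 - 2⁻¹ ^ (k + 1) - 2⁻¹ ^ (k' + 1)), Finset.prod_insert n₁, Finset.prod_insert n₂,
    Finset.prod_pair hsr', Finset.card_insert_of_notMem n₁, Finset.card_insert_of_notMem n₂,
    Finset.card_pair hsr']
  · simp only [if_true, if_neg hsr.symm, if_neg h₁, if_neg h₂, if_neg h₃, if_neg h₄,
      if_neg hsr'.symm, ticketLaw_sender hk, ticketLaw_receiver hk, ticketLaw_sender hk',
      ticketLaw_receiver hk', pairWeight]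
    ring
  · intro v hv
    simp only [Finset.mem_insert, Finset.mem_singleton, not_or] at hv
    obtain ⟨v₁, v₂, v₃, v₄⟩ := hv
    simp only [if_neg v₁, if_neg v₂, if_neg v₃, if_neg v₄, ticketLaw_avoid_two hk hk' hne]

/-- Slot `k` is the only one that is drawn by exactly one sender and one receiver. -/
def OnlyPairIn (L : ℕ) (τ : Fin n → ℕ × Bool) (k : ℕ) (s r : Fin n) : Prop :=
  PairIn τ k s r ∧ ∀ k' < L, k' ≠ k → ∀ s' r', ¬ PairIn τ k' s' r'

/-- This prepares a union bound. A second pair sits in another slot, hence avoids `s` and `r`, so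
the two pairs comprise four distinct devices. -/
theorem pairIn_diff_subset (k : ℕ) (s r : Fin n) :
    {τ : Fin n → ℕ × Bool | PairIn τ k s r} ⊆ {τ | OnlyPairIn L τ k s r} ∪
      ⋃ k' ∈ (Finset.range L).erase k, ⋃ p ∈ (({s, r} : Finset (Fin n))ᶜ).offDiag,
        {τ | PairIn τ k s r ∧ PairIn τ k' p.1 p.2} := by
  intro τ hτ
  by_cases hg : OnlyPairIn L τ k s r
  · exact Or.inl hg
  · right
    simp only [OnlyPairIn, not_and, not_forall, not_not] at hg
    obtain ⟨k', hk', hne, s', r', hp⟩ := hg hτ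
    have hmem : ∀ x, (τ x).1 = k' → x ∈ ({s, r} : Finset (Fin n))ᶜ := by
      intro x hx
      simp only [Finset.mem_compl, Finset.mem_insert, Finset.mem_singleton, not_or]
      constructor
      · rintro rfl
        rw [hτ.1] at hx
        exact hne hx.symm
      · rintro rfl
        rw [hτ.2.1] at hx
        exact hne hx.symm
    simp only [Set.mem_iUnion]
    exact ⟨k', by simp [hk', hne], (s', r'), Finset.mem_offDiag.2
      ⟨hmem _ (by rw [hp.1]), hmem _ (by rw [hp.2.1]), hp.ne⟩, hτ, hp⟩

/-- The union bound over second pairs loses at most half: each pair carries a factor `pairWeight`,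
and the remaining sum over slots is at most 32 by `sum_pair_prob_le`. -/
theorem ticketsLaw_onlyPairIn_ge {k : ℕ} (hk : k < L) {s r : Fin n} (hsr : s ≠ r) :
    pairWeight / 2 * (2⁻¹ ^ (k + 1)) ^ 2 * (1 - 2⁻¹ ^ (k + 1)) ^ (n - 2) ≤
      (ticketsLaw n L).real {τ | OnlyPairIn L τ k s r} := by
  set N := n - 2 with hN
  set q : ℝ := 2⁻¹ ^ (k + 1) with hq
  have hw₀ : 0 ≤ pairWeight := by norm_num [pairWeight]
  have hw₁ : pairWeight ≤ 1 / 1024 := by norm_num [pairWeight]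
  have hhalf : ∀ m : ℕ, (2⁻¹ : ℝ) ^ (m + 1) ≤ 1 / 2 := fun m => by
    rw [pow_succ]
    have : (2⁻¹ : ℝ) ^ m ≤ 1 := pow_le_one₀ (by norm_num) (by norm_num)
    linarith
  have hq₀ : 0 < q := by positivity
  have hq₁ : q ≤ 1 / 2 := hhalf k
  have hpow : 0 ≤ (1 - q) ^ N := pow_nonneg (by linarith) _
  have hcard : (({s, r} : Finset (Fin n))ᶜ).offDiag.card = N * (N - 1) := by
    rw [Finset.offDiag_card, Finset.card_compl, Finset.card_pair hsr, Fintype.card_fin, ← hN,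
      Nat.mul_sub_one]
  have hterm : ∀ k' ∈ (Finset.range L).erase k,
      ∑ p ∈ (({s, r} : Finset (Fin n))ᶜ).offDiag,
        (ticketsLaw n L).real {τ | PairIn τ k s r ∧ PairIn τ k' p.1 p.2} ≤
      4 * pairWeight ^ 2 * q ^ 2 * (1 - q) ^ N *
        (((N * (N - 1) : ℕ) : ℝ) * ((2⁻¹ : ℝ) ^ (k' + 1)) ^ 2 *
          (1 - (2⁻¹ : ℝ) ^ (k' + 1)) ^ (N - 2)) := by
    intro k' hk'
    rw [Finset.mem_erase, Finset.mem_range] at hk'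
    have hq'₁ := hhalf k'
    have hq'₀ : 0 < (2⁻¹ : ℝ) ^ (k' + 1) := by positivity
    have hval : ∀ p ∈ (({s, r} : Finset (Fin n))ᶜ).offDiag,
        (ticketsLaw n L).real {τ | PairIn τ k s r ∧ PairIn τ k' p.1 p.2} =
          pairWeight ^ 2 * q ^ 2 * (2⁻¹ ^ (k' + 1)) ^ 2 *
            (1 - q - 2⁻¹ ^ (k' + 1)) ^ (N - 2) := by
      intro p hp
      simp only [Finset.mem_offDiag, Finset.mem_compl, Finset.mem_insert, Finset.mem_singleton,
        not_or] at hp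
      obtain ⟨⟨a₁, a₂⟩, ⟨b₁, b₂⟩, c⟩ := hp
      rw [ticketsLaw_two_pairs hk hk'.2 hk'.1 hsr c a₁ a₂ b₁ b₂, hN, Nat.sub_sub]
    rw [Finset.sum_congr rfl hval, Finset.sum_const, hcard, nsmul_eq_mul]
    rcases lt_or_ge N 2 with hN2 | hN2
    · have : N * (N - 1) = 0 := by interval_cases N <;> rfl
      simp [this]
    generalize (2⁻¹ : ℝ) ^ (k' + 1) = q' at *
    -- Avoiding both slots is at most as likely as under independence; restoring two powers of `1 -
    -- q ≥ 1 / 2` costs the factor 4.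
    have h₁ : (1 - q - q') ^ (N - 2) ≤ 4 * (1 - q) ^ N * (1 - q') ^ (N - 2) := by
      have h₂ : (1 - q - q') ^ (N - 2) ≤ ((1 - q) * (1 - q')) ^ (N - 2) :=
        pow_le_pow_left₀ (by linarith) (by nlinarith) _
      have h₃ : (1 - q) ^ N = (1 - q) ^ (N - 2) * (1 - q) ^ 2 := by
        rw [← pow_add]; congr 1; omega
      have h₄ : 1 ≤ 4 * (1 - q) ^ 2 := by nlinarith
      have h₅ : 0 ≤ (1 - q) ^ (N - 2) * (1 - q') ^ (N - 2) :=
        mul_nonneg (pow_nonneg (by linarith) _) (pow_nonneg (by linarith) _)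
      rw [mul_pow] at h₂
      rw [h₃]
      nlinarith
    calc _ ≤ ((N * (N - 1) : ℕ) : ℝ) * (pairWeight ^ 2 * q ^ 2 * q' ^ 2 *
          (4 * (1 - q) ^ N * (1 - q') ^ (N - 2))) := by gcongr
      _ = _ := by ring
  have hsub := (measureReal_mono (μ := ticketsLaw n L) (pairIn_diff_subset (L := L) k s r)).trans
    (measureReal_union_le _ _)
  rw [ticketsLaw_pairIn hk hsr] at hsub
  have hbad : (ticketsLaw n L).real
      (⋃ k' ∈ (Finset.range L).erase k, ⋃ p ∈ (({s, r} : Finset (Fin n))ᶜ).offDiag,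
        {τ | PairIn τ k s r ∧ PairIn τ k' p.1 p.2}) ≤
      pairWeight / 2 * q ^ 2 * (1 - q) ^ N := by
    calc _ ≤ ∑ k' ∈ (Finset.range L).erase k, (ticketsLaw n L).real
          (⋃ p ∈ (({s, r} : Finset (Fin n))ᶜ).offDiag,
            {τ | PairIn τ k s r ∧ PairIn τ k' p.1 p.2}) := measureReal_biUnion_finset_le _ _
      _ ≤ ∑ k' ∈ (Finset.range L).erase k, ∑ p ∈ (({s, r} : Finset (Fin n))ᶜ).offDiag,
            (ticketsLaw n L).real {τ | PairIn τ k s r ∧ PairIn τ k' p.1 p.2} :=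
          Finset.sum_le_sum fun k' _ => measureReal_biUnion_finset_le _ _
      _ ≤ ∑ k' ∈ (Finset.range L).erase k, 4 * pairWeight ^ 2 * q ^ 2 * (1 - q) ^ N *
          (((N * (N - 1) : ℕ) : ℝ) * ((2⁻¹ : ℝ) ^ (k' + 1)) ^ 2 *
            (1 - (2⁻¹ : ℝ) ^ (k' + 1)) ^ (N - 2)) := Finset.sum_le_sum hterm
      _ ≤ ∑ k' ∈ Finset.range L, 4 * pairWeight ^ 2 * q ^ 2 * (1 - q) ^ N *
          (((N * (N - 1) : ℕ) : ℝ) * ((2⁻¹ : ℝ) ^ (k' + 1)) ^ 2 *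
            (1 - (2⁻¹ : ℝ) ^ (k' + 1)) ^ (N - 2)) := by
          refine Finset.sum_le_sum_of_subset_of_nonneg (Finset.erase_subset _ _) fun m _ _ => ?_
          have : 0 ≤ (1 - (2⁻¹ : ℝ) ^ (m + 1)) := by linarith [hhalf m]
          positivity
      _ ≤ 4 * pairWeight ^ 2 * q ^ 2 * (1 - q) ^ N * 32 := by
          rw [← Finset.mul_sum]
          exact mul_le_mul_of_nonneg_left (sum_pair_prob_le N L) (by positivity)
      -- Here `4 * 32 * pairWeight ^ 2 ≤ pairWeight / 2`, because `pairWeight ≤ 1 / 1024`. This is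
      -- why senders are rare.
      _ ≤ _ := by
          have h₁ : 0 ≤ pairWeight * q ^ 2 * (1 - q) ^ N := by positivity
          nlinarith
  rw [← hq, ← hN] at hsub
  linarith

/-- The probability of good tickets is bounded below if there are enough slots. -/
theorem ticketsLaw_good_ge (hn : 2 ≤ n) (hL : Nat.log 2 n ≤ L) :
    (2⁻¹ : ℝ) ^ 17 ≤ (ticketsLaw n L).real {τ | GoodTickets L τ} := by
  -- Slot `k` has probability `2⁻¹ ^ (k + 1)` between `1 / n` and `2 / n`, so boundedly many devices
  -- are expected in it.
  obtain ⟨k, hk⟩ : ∃ k, Nat.log 2 n = k + 1 :=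
    Nat.exists_eq_succ_of_ne_zero (Nat.log_pos (by norm_num) hn).ne'
  have hkL : k < L := by omega
  have hlow : 2 ^ (k + 1) ≤ n := hk ▸ Nat.pow_log_le_self 2 (by omega)
  have hup : n < 2 ^ (k + 2) := by
    have := Nat.lt_pow_succ_log_self (b := 2) (by norm_num) n
    rwa [hk] at this
  -- The tickets determine the pair in slot `k`, so the probabilities for different ordered pairs
  -- add up.
  have hdisj : Set.PairwiseDisjoint (↑((Finset.univ : Finset (Fin n)).offDiag))
      fun p : Fin n × Fin n => {τ : Fin n → ℕ × Bool | OnlyPairIn L τ k p.1 p.2} := by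
    rintro ⟨s, r⟩ - ⟨s', r'⟩ - hne
    refine Set.disjoint_left.2 fun τ h h' => hne ?_
    obtain ⟨⟨h₁, h₂, h₃⟩, -⟩ := h
    obtain ⟨⟨h₁', h₂', -⟩, -⟩ := h'
    dsimp only at h₁ h₂ h₃ h₁' h₂'
    have hs : s' = s := by
      by_contra hs
      refine h₃ s' hs ?_ (by rw [h₁'])
      rintro rfl
      rw [h₁'] at h₂
      simp at h₂
    have hr : r' = r := by
      by_contra hr
      refine h₃ r' ?_ hr (by rw [h₂'])
      rintro rfl
      rw [h₂'] at h₁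
      simp at h₁
    rw [hs, hr]
  have hsub : (⋃ p ∈ (Finset.univ : Finset (Fin n)).offDiag,
      {τ : Fin n → ℕ × Bool | OnlyPairIn L τ k p.1 p.2}) ⊆ {τ | GoodTickets L τ} := by
    intro τ hτ
    simp only [Set.mem_iUnion] at hτ
    obtain ⟨p, -, hp⟩ := hτ
    exact ⟨k, hkL, p.1, p.2, hp⟩
  have hsum := measureReal_mono (μ := ticketsLaw n L) hsub
  rw [measureReal_biUnion_finset hdisj fun _ _ => .of_discrete] at hsum
  refine le_trans ?_ hsum
  set q : ℝ := 2⁻¹ ^ (k + 1) with hq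
  have hq₀ : 0 < q := by positivity
  have hq₁ : q ≤ 1 := pow_le_one₀ (by norm_num) (by norm_num)
  have hge : ∀ p ∈ (Finset.univ : Finset (Fin n)).offDiag,
      pairWeight / 2 * q ^ 2 * (1 / 16) ≤
        (ticketsLaw n L).real {τ : Fin n → ℕ × Bool | OnlyPairIn L τ k p.1 p.2} := by
    intro p hp
    refine le_trans ?_ (ticketsLaw_onlyPairIn_ge hkL (Finset.mem_offDiag.1 hp).2.2)
    have h₁ : 1 / 16 ≤ (1 - (2⁻¹ : ℝ) ^ (k + 1)) ^ (n - 2) :=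
      one_sixteenth_le_pow (by rw [pow_add] at hup; omega)
    have h₂ : 0 ≤ pairWeight := by norm_num [pairWeight]
    gcongr
  refine le_trans ?_ (Finset.sum_le_sum hge)
  rw [Finset.sum_const, Finset.offDiag_card, Finset.card_univ, Fintype.card_fin, nsmul_eq_mul,
    Nat.cast_sub (Nat.le_mul_self n), Nat.cast_mul]
  have hnq : 1 ≤ (n : ℝ) * q := by
    have h₁ : ((2 : ℝ) ^ (k + 1)) ≤ n := by exact_mod_cast hlow
    have h₂ : (2 : ℝ) ^ (k + 1) * q = 1 := by rw [hq, ← mul_pow]; norm_num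
    nlinarith
  have hn' : (2 : ℝ) ≤ n := by exact_mod_cast hn
  have hmain : 1 / 2 ≤ ((n : ℝ) * n - n) * q ^ 2 := by
    have h₁ : 1 / 2 ≤ ((n : ℝ) - 1) * q := by nlinarith
    calc (1 / 2 : ℝ) ≤ (((n : ℝ) - 1) * q) * (n * q) := by nlinarith
      _ = _ := by ring
  have hw : (2⁻¹ : ℝ) ^ 11 ≤ pairWeight := by norm_num [pairWeight]
  -- The factors are: `pairWeight`, the loss from second pairs, the other devices avoiding the slot,
  -- and the number of ordered pairs times `q ^ 2`.
  calc (2⁻¹ : ℝ) ^ 17 = (2⁻¹) ^ 11 / 2 * (1 / 16) * (1 / 2) := by norm_num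
    _ ≤ pairWeight / 2 * (1 / 16) * (((n : ℝ) * n - n) * q ^ 2) := by gcongr
    _ = _ := by ring

end GoodProbability

/-! ### Independence of the phases and the geometric tail -/

open ProbabilityTheory in
/-- Disjoint subfamilies of a countable family of independent random variables are independent. -/
theorem iIndepFun_curry {Ω ι κ 𝓧 : Type*} [MeasurableSpace Ω] [MeasurableSpace 𝓧] [Countable ι]
    [Countable κ] {P : Measure Ω} [IsProbabilityMeasure P] {X : ι × κ → Ω → 𝓧}
    (hX : ∀ p, Measurable (X p)) (h : iIndepFun X P) :
    iIndepFun (fun i ω k => X (i, k) ω) P := by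
  have hp : ∀ p, IsProbabilityMeasure (P.map (X p)) :=
    fun p => Measure.isProbabilityMeasure_map (hX p).aemeasurable
  have hm : ∀ i, Measurable fun ω k => X (i, k) ω := fun i => measurable_pi_lambda _ fun k => hX _
  have hi : ∀ i, P.map (fun ω k => X (i, k) ω) = Measure.infinitePi fun k => P.map (X (i, k)) :=
    fun i => (iIndepFun_iff_map_fun_eq_infinitePi_map fun k => hX (i, k)).1
      (h.precomp (g := fun k => (i, k)) fun _ _ hk => (Prod.mk.inj hk).2)
  rw [iIndepFun_iff_map_fun_eq_infinitePi_map hm]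
  simp only [hi]
  rw [← Measure.infinitePi_map_curry (fun i k => P.map (X (i, k))),
    ← (iIndepFun_iff_map_fun_eq_infinitePi_map hX).1 h,
    Measure.map_map (MeasurableEquiv.measurable _) (measurable_pi_lambda _ hX)]
  rfl

section Independence

variable {n : ℕ} (L : ℕ → ℕ)

open ProbabilityTheory in
-- `Nat.pair` is injective, so different phases read disjoint blocks of the independent bits.
theorem iIndepFun_phaseBits (n : ℕ) :
    iIndepFun (fun (j : ℕ) (ω : Fin n → Seed) (p : Fin n × ℕ) => ω p.1 (Nat.pair j p.2))
      (seedsMeasure n) := by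
  have h₁ : iIndepFun (fun (p : Fin n × ℕ) (ω : Fin n → Seed) => ω p.1 p.2) (seedsMeasure n) := by
    rw [seedsMeasure, ← Measure.infinitePi_eq_pi]
    exact iIndepFun_uncurry_infinitePi' (X := fun _ _ b => b)
      (fun (_ : Fin n) (_ : ℕ) => (PMF.uniformOfFintype Bool).toMeasure) fun _ _ => measurable_id
  have h₂ := h₁.precomp (g := fun p : ℕ × (Fin n × ℕ) => (p.2.1, Nat.pair p.1 p.2.2)) (by
    rintro ⟨j, v, i⟩ ⟨j', v', i'⟩ h
    simp only [Prod.mk.injEq, Nat.pair_eq_pair] at h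
    obtain ⟨rfl, rfl, rfl⟩ := h
    rfl)
  exact iIndepFun_curry
    (X := fun (p : ℕ × (Fin n × ℕ)) (ω : Fin n → Seed) => ω p.2.1 (Nat.pair p.1 p.2.2))
    (fun p => (measurable_pi_apply _).comp (measurable_pi_apply _)) h₂

open ProbabilityTheory in
theorem iIndepFun_tickets (n : ℕ) :
    iIndepFun (fun (j : ℕ) (ω : Fin n → Seed) => tickets L ω j) (seedsMeasure n) :=
  (iIndepFun_phaseBits n).comp (fun j x v => ticket (L j) fun i => x (v, i)) fun j =>
    measurable_pi_lambda _ fun _ => (measurable_ticket (L j)).comp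
      (measurable_pi_lambda _ fun _ => measurable_pi_apply _)

theorem measurable_tickets (j : ℕ) : Measurable fun ω : Fin n → Seed => tickets L ω j :=
  measurable_pi_lambda _ fun v => (measurable_ticket (L j)).comp
    ((measurable_phaseBits j).comp (measurable_pi_apply v))

theorem setOf_noGoodBefore_eq (j : ℕ) : {ω : Fin n → Seed | NoGoodBefore L ω j} =
    ⋂ i ∈ Finset.range j, (fun ω => tickets L ω i) ⁻¹' {τ | ¬ GoodTickets (L i) τ} := by
  ext ω
  simp [NoGoodBefore]

theorem measurableSet_noGoodBefore (j : ℕ) :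
    MeasurableSet {ω : Fin n → Seed | NoGoodBefore L ω j} := by
  rw [setOf_noGoodBefore_eq]
  exact Finset.measurableSet_biInter _ fun i _ => measurable_tickets L i (.of_discrete)

theorem seedsMeasure_noGoodBefore (j : ℕ) :
    seedsMeasure n {ω | NoGoodBefore L ω j} =
      ∏ i ∈ Finset.range j, ticketsLaw n (L i) {τ | ¬ GoodTickets (L i) τ} := by
  rw [setOf_noGoodBefore_eq,
    (iIndepFun_tickets L n).measure_inter_preimage_eq_mul _ fun _ _ => .of_discrete]
  refine Finset.prod_congr rfl fun i _ => ?_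
  rw [← Measure.map_apply (measurable_tickets L i) (.of_discrete), map_tickets]

theorem ticketsLaw_not_good_le {l : ℕ} (hn : 2 ≤ n) (hl : Nat.log 2 n ≤ l) :
    ticketsLaw n l {τ | ¬ GoodTickets l τ} ≤ ENNReal.ofReal (1 - 2⁻¹ ^ 17) := by
  rw [← ofReal_measureReal]
  refine ENNReal.ofReal_le_ofReal ?_
  have h₁ := probReal_compl_eq_one_sub (μ := ticketsLaw n l) (s := {τ | GoodTickets l τ})
    (.of_discrete)
  have h₂ := ticketsLaw_good_ge hn hl
  change (ticketsLaw n l).real {τ | GoodTickets l τ}ᶜ ≤ _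
  linarith

variable {L}

/-- If all phases from `j₀` on have enough slots, the number of phases has a geometric tail. -/
theorem seedsMeasure_noGoodBefore_le {j₀ : ℕ} (hn : 2 ≤ n)
    (hL : ∀ j, j₀ ≤ j → Nat.log 2 n ≤ L j) (j : ℕ) :
    seedsMeasure n {ω | NoGoodBefore L ω j} ≤ ENNReal.ofReal ((1 - 2⁻¹ ^ 17) ^ (j - j₀)) := by
  rw [seedsMeasure_noGoodBefore]
  induction j with
  | zero => simp
  | succ j ih =>
    rw [Finset.prod_range_succ]
    rcases lt_or_ge j j₀ with hj | hj
    -- Before phase `j₀` the truncated exponent stays 0, and the trivial bound 1 on the new factor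
    -- suffices.
    · rw [show j + 1 - j₀ = j - j₀ by omega]
      exact (mul_le_mul' ih prob_le_one).trans_eq (mul_one _)
    · rw [Nat.succ_sub hj, pow_succ, ENNReal.ofReal_mul (pow_nonneg (by norm_num) _)]
      exact mul_le_mul' ih (ticketsLaw_not_good_le hn (hL j hj))

open scoped Classical in
theorem lintegral_phase_cost_le {j₀ : ℕ} (hn : 2 ≤ n)
    (hL : ∀ j, j₀ ≤ j → Nat.log 2 n ≤ L j) (c : ℕ → ℝ≥0∞) :
    ∫⁻ ω, (∑' j, if NoGoodBefore L ω j then c j else 0) ∂seedsMeasure n ≤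
      ∑' j, c j * ENNReal.ofReal ((1 - 2⁻¹ ^ 17) ^ (j - j₀)) := by
  have hind : ∀ j, (fun ω : Fin n → Seed => if NoGoodBefore L ω j then c j else 0) =
      {ω | NoGoodBefore L ω j}.indicator fun _ => c j := by
    intro j
    ext ω
    simp [Set.indicator_apply]
  rw [lintegral_tsum fun j => ?_]
  · refine ENNReal.tsum_le_tsum fun j => ?_
    rw [hind, lintegral_indicator_const (measurableSet_noGoodBefore L j)]
    exact mul_le_mul' le_rfl (seedsMeasure_noGoodBefore_le hn hL j)
  · rw [hind]
    exact (measurable_const.indicator (measurableSet_noGoodBefore L j)).aemeasurable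

end Independence

/-- A sum of weights growing at rate `α` against a geometric tail that starts at `j₀`. -/
theorem tsum_pow_mul_tail_le {α d : ℝ} (hα : 0 ≤ α) (hd : 0 ≤ d) (hαd : α * d < 1) (j₀ : ℕ) :
    ∑' j, ENNReal.ofReal (α ^ j) * ENNReal.ofReal (d ^ (j - j₀)) ≤
      ENNReal.ofReal (∑ j ∈ Finset.range j₀, α ^ j + α ^ j₀ * (1 - α * d)⁻¹) := by
  have hαd₀ : 0 ≤ α * d := mul_nonneg hα hd
  rw [← Summable.sum_add_tsum_nat_add' (k := j₀) ENNReal.summable,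
    ENNReal.ofReal_add (Finset.sum_nonneg fun _ _ => pow_nonneg hα _)
      (mul_nonneg (pow_nonneg hα _) (inv_nonneg.2 (by linarith))),
    ENNReal.ofReal_sum_of_nonneg fun _ _ => pow_nonneg hα _]
  refine add_le_add (Finset.sum_le_sum fun j hj => ?_) (le_of_eq ?_)
  · rw [Nat.sub_eq_zero_of_le (Finset.mem_range.1 hj).le]
    simp
  · rw [← tsum_geometric_of_lt_one hαd₀ hαd, ← tsum_mul_left, ENNReal.ofReal_tsum_of_nonneg
      (fun i => mul_nonneg (pow_nonneg hα _) (pow_nonneg hαd₀ _))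
      ((summable_geometric_of_lt_one hαd₀ hαd).mul_left _)]
    refine tsum_congr fun i => ?_
    rw [← ENNReal.ofReal_mul (pow_nonneg hα _), Nat.add_sub_cancel]
    congr 1
    ring

/-! ### Choice of the slot numbers and final bounds -/

section Bounds

/-- The numbers of slots of the phases grow geometrically at this rate. -/
noncomputable def growth : ℝ := 1 + 2⁻¹ ^ 17

theorem one_lt_growth : 1 < growth := by norm_num [growth]

theorem growth_le_two : growth ≤ 2 := by norm_num [growth]

/-- The product is `1 - 2⁻¹ ^ 34`: phases lengthen more slowly than the probability of reaching them
decays. -/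
theorem growth_mul_lt_one : growth * (1 - 2⁻¹ ^ 17) < 1 := by norm_num [growth]

/-- The number of slots in phase `j`. -/
noncomputable def slots (j : ℕ) : ℕ := ⌈growth ^ j⌉₊

/-- The first phase that surely has at least `Real.logb 2 n` slots. -/
noncomputable def criticalPhase (n : ℕ) : ℕ := ⌈Real.logb growth (Real.logb 2 n)⌉₊

variable {n : ℕ}

theorem one_le_logb (hn : 2 ≤ n) : 1 ≤ Real.logb 2 n := by
  rw [Real.le_logb_iff_rpow_le (by norm_num) (by positivity), Real.rpow_one]
  exact_mod_cast hn

theorem log_le_slots (hn : 2 ≤ n) {j : ℕ} (hj : criticalPhase n ≤ j) : Nat.log 2 n ≤ slots j := by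
  have h₁ : ((Nat.log 2 n : ℕ) : ℝ) ≤ Real.logb 2 n := by
    exact_mod_cast Real.natLog_le_logb n 2
  have h₂ : Real.logb 2 n ≤ growth ^ j := by
    rw [← Real.rpow_natCast, ← Real.logb_le_iff_le_rpow one_lt_growth (by linarith [one_le_logb hn])]
    exact (Nat.le_ceil _).trans (by exact_mod_cast hj)
  exact_mod_cast (h₁.trans h₂).trans (Nat.le_ceil (growth ^ j))

theorem criticalPhase_le (hn : 2 ≤ n) :
    (criticalPhase n : ℝ) ≤ Real.logb growth (Real.logb 2 n) + 1 :=
  (Nat.ceil_lt_add_one (Real.logb_nonneg one_lt_growth (one_le_logb hn))).le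

theorem growth_pow_criticalPhase_le (hn : 2 ≤ n) :
    growth ^ criticalPhase n ≤ 2 * Real.logb 2 n := by
  have h₀ : 0 < growth := by linarith [one_lt_growth]
  have h₁ : 0 < Real.logb 2 n := by linarith [one_le_logb hn]
  calc growth ^ criticalPhase n = growth ^ (criticalPhase n : ℝ) := (Real.rpow_natCast _ _).symm
    _ ≤ growth ^ (Real.logb growth (Real.logb 2 n) + 1) :=
        Real.rpow_le_rpow_of_exponent_le one_lt_growth.le (criticalPhase_le hn)
    _ = Real.logb 2 n * growth := by
        rw [Real.rpow_add h₀, Real.rpow_logb h₀ one_lt_growth.ne' h₁, Real.rpow_one]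
    _ ≤ 2 * Real.logb 2 n := by nlinarith [growth_le_two]

theorem expectedTime_le (hn : 2 ≤ n) :
    (election slots).expectedTime n ≤ ENNReal.ofReal (2 ^ 50 * Real.logb 2 n) := by
  classical
  have h₀ : 0 ≤ growth := by linarith [one_lt_growth]
  -- For `x = growth ^ j ≥ 1`, rounding up gives `2 * ⌈x⌉₊ + 3 ≤ 2 * x + 5 ≤ 7 * x`.
  have hlen : ∀ j, ((2 * slots j + 3 : ℕ) : ℝ≥0∞) ≤ 7 * ENNReal.ofReal (growth ^ j) := by
    intro j
    have h₁ : 1 ≤ growth ^ j := one_le_pow₀ one_lt_growth.le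
    have h₂ : (slots j : ℝ) < growth ^ j + 1 := Nat.ceil_lt_add_one (by linarith)
    rw [← ENNReal.ofReal_natCast, ← ENNReal.ofReal_ofNat 7, ← ENNReal.ofReal_mul (by norm_num)]
    refine ENNReal.ofReal_le_ofReal ?_
    push_cast
    linarith
  calc (election slots).expectedTime n
      ≤ ∫⁻ ω, (∑' j, if NoGoodBefore slots ω j then ((2 * slots j + 3 : ℕ) : ℝ≥0∞) else 0)
          ∂seedsMeasure n := lintegral_mono fun ω => time_le
    _ ≤ ∑' j, ((2 * slots j + 3 : ℕ) : ℝ≥0∞) *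
          ENNReal.ofReal ((1 - 2⁻¹ ^ 17) ^ (j - criticalPhase n)) :=
        lintegral_phase_cost_le hn (fun j hj => log_le_slots hn hj) _
    _ ≤ ∑' j, 7 * (ENNReal.ofReal (growth ^ j) *
          ENNReal.ofReal ((1 - 2⁻¹ ^ 17) ^ (j - criticalPhase n))) := by
        refine ENNReal.tsum_le_tsum fun j => ?_
        rw [← mul_assoc]
        exact mul_le_mul' (hlen j) le_rfl
    _ ≤ 7 * ENNReal.ofReal (∑ j ∈ Finset.range (criticalPhase n), growth ^ j +
          growth ^ criticalPhase n * (1 - growth * (1 - 2⁻¹ ^ 17))⁻¹) := by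
        rw [ENNReal.tsum_mul_left]
        exact mul_le_mul' le_rfl (tsum_pow_mul_tail_le h₀ (by norm_num) growth_mul_lt_one _)
    _ ≤ ENNReal.ofReal (2 ^ 50 * Real.logb 2 n) := by
        rw [← ENNReal.ofReal_ofNat 7, ← ENNReal.ofReal_mul (by norm_num)]
        refine ENNReal.ofReal_le_ofReal ?_
        have h₁ := growth_pow_criticalPhase_le hn
        have h₂ : 1 ≤ growth ^ criticalPhase n := one_le_pow₀ one_lt_growth.le
        -- With `x ≤ 2 * Real.logb 2 n`, the total is at most `7 * x * (2 ^ 17 + 2 ^ 34)`, well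
        -- below `2 ^ 50 * Real.logb 2 n`.
        rw [geom_sum_eq one_lt_growth.ne',
          show growth - 1 = 2⁻¹ ^ 17 by norm_num [growth],
          show (1 - growth * (1 - 2⁻¹ ^ 17))⁻¹ = 2 ^ 34 by norm_num [growth]]
        generalize growth ^ criticalPhase n = x at *
        norm_num
        linarith

/-- The constant in front of the double logarithm in the energy bound. -/
noncomputable def energyConstant : ℝ := 5 * ((Real.logb 2 growth)⁻¹ + 1 + 2 ^ 17)

/-- The cost per phase is constant, so the tail sum is used with weight 1: the expected number of
phases is at most `criticalPhase n + 2 ^ 17`. -/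
theorem expectedEnergy_le (hn : 2 ≤ n) :
    (election slots).expectedEnergy n ≤
      ENNReal.ofReal (energyConstant * (1 + Real.logb 2 (Real.logb 2 n))) := by
  classical
  calc (election slots).expectedEnergy n
      ≤ ∫⁻ ω, (∑' j, if NoGoodBefore slots ω j then (5 : ℝ≥0∞) else 0) ∂seedsMeasure n :=
        lintegral_mono fun ω => energy_le
    _ ≤ ∑' j, 5 * ENNReal.ofReal ((1 - 2⁻¹ ^ 17) ^ (j - criticalPhase n)) :=
        lintegral_phase_cost_le hn (fun j hj => log_le_slots hn hj) _
    _ ≤ 5 * ENNReal.ofReal (∑ j ∈ Finset.range (criticalPhase n), 1 ^ j +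
          1 ^ criticalPhase n * (1 - 1 * (1 - 2⁻¹ ^ 17))⁻¹) := by
        rw [ENNReal.tsum_mul_left]
        refine mul_le_mul' le_rfl (le_trans (le_of_eq ?_)
          (tsum_pow_mul_tail_le zero_le_one (d := 1 - 2⁻¹ ^ 17) (by norm_num) (by norm_num) _))
        simp
    _ ≤ ENNReal.ofReal (energyConstant * (1 + Real.logb 2 (Real.logb 2 n))) := by
        rw [← ENNReal.ofReal_ofNat 5, ← ENNReal.ofReal_mul (by norm_num)]
        refine ENNReal.ofReal_le_ofReal ?_
        have h₁ := criticalPhase_le hn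
        have h₂ : Real.logb growth (Real.logb 2 n) =
            Real.logb 2 (Real.logb 2 n) * (Real.logb 2 growth)⁻¹ := by
          rw [← div_eq_mul_inv]
          simp only [Real.logb]
          rw [div_div_div_cancel_right₀ (Real.log_pos one_lt_two).ne']
        have h₃ : 0 ≤ Real.logb 2 (Real.logb 2 n) :=
          Real.logb_nonneg (by norm_num) (one_le_logb hn)
        have h₄ : 0 ≤ (Real.logb 2 growth)⁻¹ :=
          inv_nonneg.2 (Real.logb_nonneg (by norm_num) one_lt_growth.le)
        rw [h₂] at h₁
        rw [energyConstant, show (1 - 1 * (1 - 2⁻¹ ^ 17) : ℝ)⁻¹ = 2 ^ 17 by norm_num]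
        simp only [one_pow, Finset.sum_const, Finset.card_range, nsmul_eq_mul, mul_one, one_mul]
        nlinarith

theorem electsLeader (hn : 2 ≤ n) : (election slots).ElectsLeader n := by
  refine ⟨fun ω t v hv => exists_electedAt_of_terminated hv, ?_⟩
  -- Endless failure implies failure up to every given phase, so its probability lies below a
  -- sequence tending to 0.
  have htail : ∀ j, seedsMeasure n {ω | ∀ i, NoGoodBefore slots ω i} ≤
      ENNReal.ofReal ((1 - 2⁻¹ ^ 17) ^ j) := fun j => by
    have := seedsMeasure_noGoodBefore_le hn (fun j hj => log_le_slots hn hj) (j + criticalPhase n)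
    rw [Nat.add_sub_cancel] at this
    have hsub : {ω : Fin n → Seed | ∀ i, NoGoodBefore slots ω i} ⊆
        {ω | NoGoodBefore slots ω (j + criticalPhase n)} := fun ω hω => hω _
    exact (measure_mono hsub).trans this
  have hlim : Filter.Tendsto (fun j : ℕ => ENNReal.ofReal ((1 - 2⁻¹ ^ 17) ^ j)) Filter.atTop
      (nhds 0) := by
    rw [← ENNReal.ofReal_zero]
    exact ENNReal.tendsto_ofReal
      (tendsto_pow_atTop_nhds_zero_of_lt_one (by norm_num) (by norm_num))
  have hzero : seedsMeasure n {ω | ∀ i, NoGoodBefore slots ω i} = 0 :=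
    le_antisymm (ge_of_tendsto' hlim htail) zero_le
  filter_upwards [measure_eq_zero_iff_ae_notMem.1 hzero] with ω hω
  simp only [not_forall] at hω
  obtain ⟨j, hj⟩ := hω
  obtain ⟨s, -, u, hu⟩ :=
    exists_electedAt_of_terminated (terminated_of_not_noGoodBefore hj le_rfl ⟨0, by omega⟩)
  exact ⟨s, u, hu⟩

end Bounds

end NoCD

theorem mainTheorem5 :
    ∃ (A : NoCD.Algorithm) (C : ℝ), ∀ n : ℕ, 2 ≤ n →
      A.ElectsLeader n ∧
      A.expectedTime n ≤ ENNReal.ofReal (C * Real.logb 2 n) ∧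
      A.expectedEnergy n ≤ ENNReal.ofReal (C * (1 + Real.logb 2 (Real.logb 2 n))) := by
  refine ⟨NoCD.election NoCD.slots, max (2 ^ 50) NoCD.energyConstant, fun n hn => ⟨?_, ?_, ?_⟩⟩
  · exact NoCD.electsLeader hn
  · refine (NoCD.expectedTime_le hn).trans (ENNReal.ofReal_le_ofReal ?_)
    exact mul_le_mul_of_nonneg_right (le_max_left _ _) (by linarith [NoCD.one_le_logb hn])
  · refine (NoCD.expectedEnergy_le hn).trans (ENNReal.ofReal_le_ofReal ?_)
    have := Real.logb_nonneg (b := 2) (by norm_num) (NoCD.one_le_logb hn)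
    exact mul_le_mul_of_nonneg_right (le_max_right _ _) (by linarith)
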